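/- Let $K$ be a global function field with field of constants the finite field $\mathbb F$ with $q$ elements, $\infty$ a place of $K$, $A\subset K$ the ring of elements regular away from $\infty$, $K_\infty$ the completion of $K$ at $\infty$ and $C_\infty$ the completed algebraic closure of $K_\infty$. Fix $r\ge 1$ and put $V=K^r$. A lattice in $V$ is a finitely generated $A$-submodule $Y\subset V$ that spans $V$ over $K$; a lattice pair $Y'|Y$ consists of lattices $Y\subset Y'$. Let $\Psi$ be the set of all $\omega\in C_\infty^r$ with $K_\infty$-linearly independent coordinates, $\mathcal O(\Psi)$ the ring of (rigid analytic) holomorphic functions on $\Psi$ and, for $\omega\in\Psi$ and $u\in V$, put $u\omega=\sum_i u_i\omega_i$ and $Y_\omega=\{y\omega\mid y\in Y\}$. For $\Lambda=Y_\omega$ and $z\in C_\infty$ let $$e^{\Lambda}(z)=z\prod_{0\ne\lambda\in\Lambda}(1-z/\lambda),\qquad d_u^Y(\omega)=e^{Y_\omega}(u\omega).$$ These products converge. For each lattice pair $Y'|Y$ and $\omega\in\Psi$ there is a unique polynomial $\varphi$ over $C_\infty$ with $e^{Y'_\omega}=\varphi\circ e^{Y_\omega}$ in which only the exponents $1,q,q^2,\dots$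 occur, with linear coefficient $1$ and of degree $[Y':Y]$; let $\Delta^{Y'|Y}(\omega)$ be its leading coefficient. For a function $g$ on the set $\mathfrak Y^*$ of pairs $(u,Y)$ with $Y$ a lattice in $V$ and $u\in V\smallsetminus Y$, with values in a multiplicatively written abelian group $M$ (put $g(u,Y)=1$ for $u\in Y$), let $$\operatorname{Disc}(g)^{Y'|Y}=\Big(\prod_{0\ne u\in Y'/Y}g(u,Y)\Big)^{-1}.$$ Call $g$ a derived distribution if $g(u,Y)$ depends only on $Y$ and the class of $u$ modulo $Y$, and $$\operatorname{Disc}(g)^{Y'|Y}\prod_{\substack{u\in V/Y\\ u\equiv v\ (\mathrm{mod}\ Y')}}g(u,Y)=g(v,Y')$$ for all lattice pairs $Y'|Y$ and all $v\in V$. Proposition. Let $Y'|Y$ be a lattice pair and $v\in V\smallsetminus Y'$. Then, as functions on $\Psi$, $$\Delta^{Y'|Y}\prod_{\substack{u\in V/Y\\ u\equiv v\ (\mathrm{mod}\ Y')}}d_u^{Y}=d_v^{Y'},$$ where the product is finite. Hence $(u,Y)\mapsto d_u^Y$ is a derived distribution with values in the group $\mathcal O(\Psi)^*$ of invertible holomorphic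 functions on $\Psi$, with discriminants $\operatorname{Disc}^{Y'|Y}=\Delta^{Y'|Y}$; and for each fixed $\omega\in\Psi$, $(u,Y)\mapsto d_u^Y(\omega)$ is a derived distribution with values in $C_\infty^*$, with discriminants $\Delta^{Y'|Y}(\omega)$. -/

import Mathlib

open scoped WithZero Polynomial NNReal RatFunc

noncomputable section

namespace DrinfeldDist

/-! ### Places of a field, the coefficient ring, the fields `K_∞` and `C_∞` -/

/-- A place of `K`, given by its normalized discrete valuation.  (If `K` is a function field over a
finite field `F`, such a valuation is trivial on `F`, because the nonzero elements of `F` are roots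
of unity.) -/
structure Place (K : Type*) [Field K] where
  v : Valuation K ℤᵐ⁰
  surjective : Function.Surjective v

namespace Place

variable {K : Type*} [Field K] (P : Place K)

/-- The ring `A` of elements of `K` that are regular at all places different from `P = ∞`. -/
def coeffRing : Subring K where
  carrier := {x | ∀ w : Place K, w ≠ P → w.v x ≤ 1}
  mul_mem' {x y} hx hy w hw := by
    rw [map_mul]; exact mul_le_one' (hx w hw) (hy w hw)
  one_mem' w _ := by rw [map_one]
  add_mem' {x y} hx hy w hw := (w.v.map_add x y).trans (max_le (hx w hw) (hy w hw))
  zero_mem' w _ := by rw [map_zero]; exact zero_le_one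
  neg_mem' {x} hx w hw := by rw [Valuation.map_neg]; exact hx w hw

/-- The number `q_∞ = q ^ d_∞` of elements of the residue field at `∞`.  The residue field of a
function field over a finite field is finite and has at least two elements, hence the maximum with
`2` has no effect; it is there in order that the definition makes sense for every field `K`. -/
def qInf : ℝ≥0 := max 2 (Nat.card (IsLocalRing.ResidueField P.v.valuationSubring) : ℝ≥0)

lemma one_lt_qInf : 1 < P.qInf := lt_of_lt_of_le one_lt_two (le_max_left _ _)

/-- The absolute value at `∞`, with `|π|⁻¹ = q_∞` for a uniformizer `π`. -/
def absVal : AbsoluteValue K ℝ where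
  toFun x := (WithZeroMulInt.toNNReal (ne_zero_of_lt P.one_lt_qInf) (P.v x) : ℝ)
  map_mul' x y := by simp
  nonneg' x := NNReal.coe_nonneg _
  eq_zero' x := by simp
  add_le' x y := by
    norm_cast
    have hm := (WithZeroMulInt.toNNReal_strictMono P.one_lt_qInf).monotone
    refine (hm (P.v.map_add x y)).trans ?_
    rw [hm.map_max]
    exact max_le (le_add_of_nonneg_right zero_le) (le_add_of_nonneg_left zero_le)

lemma absVal_add_le_max (x y : K) : P.absVal (x + y) ≤ max (P.absVal x) (P.absVal y) := by
  change ((_ : ℝ≥0) : ℝ) ≤ max ((_ : ℝ≥0) : ℝ) ((_ : ℝ≥0) : ℝ)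
  norm_cast
  have hm := (WithZeroMulInt.toNNReal_strictMono P.one_lt_qInf).monotone
  rw [← hm.map_max]
  exact hm (P.v.map_add x y)

/-- The completion `K_∞` of `K` at `∞`. -/
abbrev KInf := P.absVal.Completion

instance : IsUltrametricDist (WithAbs P.absVal) :=
  IsUltrametricDist.isUltrametricDist_of_forall_norm_add_le_max_norm
    fun x y => P.absVal_add_le_max x.ofAbs y.ofAbs

instance : IsUltrametricDist P.KInf := IsUltrametricDist.of_normedAlgebra (WithAbs P.absVal)

instance : NontriviallyNormedField P.KInf where
  non_trivial := by
    obtain ⟨x, hx⟩ := P.surjective (WithZero.exp 1)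
    refine ⟨((WithAbs.toAbs P.absVal x : WithAbs P.absVal) : P.KInf), ?_⟩
    rw [UniformSpace.Completion.norm_coe]
    change (1 : ℝ) < (WithZeroMulInt.toNNReal (ne_zero_of_lt P.one_lt_qInf) (P.v x) : ℝ)
    have h : (1 : ℤᵐ⁰) < P.v x := by rw [hx, ← WithZero.exp_zero, WithZero.exp_lt_exp]; exact one_pos
    have := WithZeroMulInt.toNNReal_strictMono P.one_lt_qInf h
    rw [map_one] at this
    exact_mod_cast this

/-- An algebraic closure of `K_∞`. -/
abbrev AlgCl := AlgebraicClosure P.KInf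

/-- The algebraic closure of `K_∞` carries the unique extension of the absolute value. -/
instance : NormedField P.AlgCl := spectralNorm.normedField P.KInf P.AlgCl

instance : NormedAlgebra P.KInf P.AlgCl := spectralNorm.normedAlgebra _ _

instance : UniformContinuousConstSMul K P.AlgCl where
  uniformContinuous_const_smul c := by
    have h : (fun x : P.AlgCl => c • x) = fun x => algebraMap K P.KInf c • x := by
      funext x; rw [algebraMap_smul]
    change UniformContinuous (fun x : P.AlgCl => c • x)
    rw [h]
    exact (uniformContinuousConstSMul_of_continuousConstSMul P.KInf P.AlgCl
      ).uniformContinuous_const_smul _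

/-- The field `C_∞`, the completed algebraic closure of `K_∞`. -/
abbrev CInf := UniformSpace.Completion P.AlgCl

instance : IsScalarTower K P.KInf P.CInf :=
  IsScalarTower.of_algebraMap_eq fun x => by
    rw [UniformSpace.Completion.algebraMap_def, UniformSpace.Completion.algebraMap_def]
    rfl

end Place

/-! ### Lattices in `V = K ^ r`, the Drinfeld space and exponential functions -/

section

variable {K : Type*} [Field K] (P : Place K) (r : ℕ)

/-- The `A`-lattices in `V = K ^ r`: finitely generated `A`-submodules of full rank `r`. -/
def Lattice := {Y : Submodule P.coeffRing (Fin r → K) // Y.IsLattice K}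

/-- The Drinfeld space `Ψ = Ψ ^ r`. -/
def drinfeldSpace : Set (Fin r → P.CInf) := {ω | LinearIndependent P.KInf ω}

variable {P r}

/-- The map `i_ω : V → C_∞`, `v ↦ v ω = ∑ v_i ω_i`. -/
def embed (ω : Fin r → P.CInf) : (Fin r → K) →ₗ[K] P.CInf := Fintype.linearCombination K ω

/-- The lattice `Y_ω = i_ω (Y)` in `C_∞`. -/
def Lattice.image (Y : Lattice P r) (ω : Fin r → P.CInf) : Submodule P.coeffRing P.CInf :=
  Y.1.map ((embed ω).restrictScalars P.coeffRing)

/-- The exponential function `e ^ Λ (z) = z ∏' (1 - z / λ)`, the product being over `0 ≠ λ ∈ Λ`. -/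
def latticeExp (Λ : Submodule P.coeffRing P.CInf) (z : P.CInf) : P.CInf :=
  z * ∏' l : {l : P.CInf // l ∈ Λ ∧ l ≠ 0}, (1 - z / l)

/-- The division function `d_u ^ Y (ω) = e ^ {Y_ω} (u ω)`. -/
def divisionFn (u : Fin r → K) (Y : Lattice P r) (ω : Fin r → P.CInf) : P.CInf :=
  latticeExp (Y.image ω) (embed ω u)

/-- `φ` is the `F`-linear polynomial attached to `Λ' | Λ`: only the exponents `1, q, q ^ 2, …`
occur (`q = #F`), the linear coefficient is `1`, the degree is the index `[Λ' : Λ]`, and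
`e ^ Λ' = φ ∘ e ^ Λ`. -/
structure IsNormalizedIsogeny (F : Type*) (Λ Λ' : Submodule P.coeffRing P.CInf)
    (φ : P.CInf[X]) : Prop where
  exponents : ∀ n, φ.coeff n ≠ 0 → ∃ i : ℕ, n = Nat.card F ^ i
  coeff_one : φ.coeff 1 = 1
  natDegree_eq : φ.natDegree = Nat.card (Λ' ⧸ Λ.submoduleOf Λ')
  exp_eq : ∀ z, latticeExp Λ' z = φ.eval (latticeExp Λ z)

open Classical in
/-- The discriminant `Δ (Λ' | Λ)`: the leading coefficient of the polynomial `φ` attached to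
`Λ' | Λ` (with value `0` if there is no such polynomial). -/
def discr (F : Type*) (Λ Λ' : Submodule P.coeffRing P.CInf) : P.CInf :=
  if h : ∃ φ, IsNormalizedIsogeny F Λ Λ' φ then h.choose.leadingCoeff else 0

/-- The discriminant function `Δ ^ {Y' | Y} (ω) = Δ (Y'_ω | Y_ω)`. -/
def discrFn (F : Type*) (Y Y' : Lattice P r) (ω : Fin r → P.CInf) : P.CInf :=
  discr F (Y.image ω) (Y'.image ω)

/-! ### Derived distributions -/

/-- The classes `u ∈ V / Y` with `u ≡ v (mod Y')`, for a lattice pair `Y' | Y`. -/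
def classesOver {Y Y' : Lattice P r} (h : Y.1 ≤ Y'.1) (v : Fin r → K) :
    Set ((Fin r → K) ⧸ Y.1) :=
  {x | Submodule.factor h x = Submodule.Quotient.mk v}

variable (P r) in
/-- The set `𝔜*` of pairs `(u, Y)` with `u ∈ V`, `Y` a lattice in `V` and `u ∉ Y`. -/
def PuncturedDomain := {x : (Fin r → K) × Lattice P r // x.1 ∉ x.2.1}

section Distributions

/-! The abelian group `M` of values is written multiplicatively. -/

variable {M : Type*} [CommGroup M] (g : PuncturedDomain P r → M)

open Classical in
/-- The extension of `g : 𝔜* → M` to all pairs `(u, Y)` by the neutral element of `M`. -/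
def extend (u : Fin r → K) (Y : Lattice P r) : M :=
  if h : u ∉ Y.1 then g ⟨(u, Y), h⟩ else 1

/-- The function on `V / Y` given by `u ↦ g (u, Y)`.  It is evaluated through representatives;
the choice is irrelevant if `g (u, Y)` depends only on the class of `u` modulo `Y`. -/
def onClasses (Y : Lattice P r) (x : (Fin r → K) ⧸ Y.1) : M := extend g x.out Y

/-- The discriminant `Disc (g) ^ {Y' | Y}` of the lattice pair `Y' | Y` with respect to `g`:
the inverse of the product of the `g (u, Y)` over `0 ≠ u ∈ Y' / Y`. -/
def Disc {Y Y' : Lattice P r} (h : Y.1 ≤ Y'.1) : M :=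
  (∏ᶠ x ∈ classesOver h 0 \ {0}, onClasses g Y x)⁻¹

/-- Derived distributions on `𝔜` with values in `M`. -/
structure IsDerivedDistribution : Prop where
  congr : ∀ (Y : Lattice P r) (u u' : Fin r → K) (hu : u ∉ Y.1) (hu' : u' ∉ Y.1),
    u - u' ∈ Y.1 → g ⟨(u, Y), hu⟩ = g ⟨(u', Y), hu'⟩
  relation : ∀ (Y Y' : Lattice P r) (h : Y.1 ≤ Y'.1) (v : Fin r → K),
    (∏ᶠ x ∈ classesOver h v, onClasses g Y x) * Disc g h = extend g v Y'

end Distributions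

/-! ### Holomorphic functions on the Drinfeld space -/

variable (P r)

/-- The algebra of functions on `Ψ` generated by the coordinates and the inverses of the unimodular
`K_∞`-linear forms `ℓ`. -/
def regularFns : Subalgebra P.CInf (drinfeldSpace P r → P.CInf) :=
  Algebra.adjoin P.CInf
    ({f | ∃ i, f = fun ω => ω.1 i} ∪
      {f | ∃ l : Fin r → P.KInf, ‖l‖ = 1 ∧ f = fun ω => (∑ i, l i • ω.1 i)⁻¹})

/-- The members `Ψ_n` of the standard exhausting affinoid covering of `Ψ`: all coordinates have
absolute value at most `q_∞ ^ n`, all unimodular `K_∞`-linear forms at least `q_∞ ^ (-n)`. -/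
def affinoid (n : ℕ) : Set (drinfeldSpace P r) :=
  {ω | (∀ i, ‖ω.1 i‖ ≤ (P.qInf : ℝ) ^ n) ∧
    ∀ l : Fin r → P.KInf, ‖l‖ = 1 → ((P.qInf : ℝ) ^ n)⁻¹ ≤ ‖∑ i, l i • ω.1 i‖}

variable {P r} in
lemma regularFns_bounded {g : drinfeldSpace P r → P.CInf} (hg : g ∈ regularFns P r) (n : ℕ) :
    ∃ C : ℝ, 0 < C ∧ ∀ ω ∈ affinoid P r n, ‖g ω‖ ≤ C := by
  have hq : 0 < (P.qInf : ℝ) ^ n := pow_pos (zero_lt_one.trans P.one_lt_qInf) n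
  induction hg using Algebra.adjoin_induction with
  | mem f hf =>
    refine ⟨_, hq, fun ω hω => ?_⟩
    rcases hf with ⟨i, rfl⟩ | ⟨l, hl, rfl⟩
    · exact hω.1 i
    · rw [norm_inv]
      exact inv_le_of_inv_le₀ hq (hω.2 l hl)
  | algebraMap c => exact ⟨‖c‖ + 1, by positivity, fun ω _ => by simp [Pi.algebraMap_apply]⟩
  | add f g _ _ hf hg =>
    obtain ⟨C, hC, hf⟩ := hf
    obtain ⟨D, hD, hg⟩ := hg
    exact ⟨C + D, by positivity,
      fun ω h => (norm_add_le _ _).trans (add_le_add (hf ω h) (hg ω h))⟩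
  | mul f g _ _ hf hg =>
    obtain ⟨C, hC, hf⟩ := hf
    obtain ⟨D, hD, hg⟩ := hg
    refine ⟨C * D, by positivity, fun ω h => ?_⟩
    rw [Pi.mul_apply, norm_mul]
    exact mul_le_mul (hf ω h) (hg ω h) (norm_nonneg _) hC.le

/-- The algebra `𝒪 (Ψ)` of holomorphic functions on `Ψ` in the sense of rigid analysis: on each
`Ψ_n`, they are uniform limits of functions in `regularFns` (which are dense in the affinoid algebra
of `Ψ_n`). -/
def holomorphicFns : Subalgebra P.CInf (drinfeldSpace P r → P.CInf) where
  carrier := {f | ∀ (n : ℕ) (ε : ℝ), 0 < ε →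
    ∃ g ∈ regularFns P r, ∀ ω ∈ affinoid P r n, ‖f ω - g ω‖ < ε}
  algebraMap_mem' c n ε hε :=
    ⟨_, (regularFns P r).algebraMap_mem c, fun ω _ => by simpa using hε⟩
  add_mem' {f f'} hf hf' n ε hε := by
    obtain ⟨g, hg, h⟩ := hf n (ε / 2) (half_pos hε)
    obtain ⟨g', hg', h'⟩ := hf' n (ε / 2) (half_pos hε)
    refine ⟨g + g', add_mem hg hg', fun ω hω => ?_⟩
    calc ‖(f + f') ω - (g + g') ω‖ = ‖(f ω - g ω) + (f' ω - g' ω)‖ := by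
          congr 1; simp only [Pi.add_apply]; ring
      _ ≤ ‖f ω - g ω‖ + ‖f' ω - g' ω‖ := norm_add_le _ _
      _ < ε / 2 + ε / 2 := add_lt_add (h ω hω) (h' ω hω)
      _ = ε := add_halves ε
  mul_mem' {f f'} hf hf' n ε hε := by
    obtain ⟨g₁, hg₁, h₁⟩ := hf n 1 one_pos
    obtain ⟨C, hC, hb⟩ := regularFns_bounded hg₁ n
    have hfb : ∀ ω ∈ affinoid P r n, ‖f ω‖ ≤ 1 + C := fun ω hω => by
      calc ‖f ω‖ = ‖(f ω - g₁ ω) + g₁ ω‖ := by rw [sub_add_cancel]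
        _ ≤ ‖f ω - g₁ ω‖ + ‖g₁ ω‖ := norm_add_le _ _
        _ ≤ 1 + C := add_le_add (h₁ ω hω).le (hb ω hω)
    obtain ⟨g', hg', h'⟩ := hf' n (ε / (2 * (1 + C))) (by positivity)
    obtain ⟨D, hD, hb'⟩ := regularFns_bounded hg' n
    obtain ⟨g, hg, h⟩ := hf n (ε / (2 * D)) (by positivity)
    refine ⟨g * g', mul_mem hg hg', fun ω hω => ?_⟩
    calc ‖(f * f') ω - (g * g') ω‖ = ‖f ω * (f' ω - g' ω) + (f ω - g ω) * g' ω‖ := by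
          congr 1; simp only [Pi.mul_apply]; ring
      _ ≤ ‖f ω‖ * ‖f' ω - g' ω‖ + ‖f ω - g ω‖ * ‖g' ω‖ := by
          refine (norm_add_le _ _).trans ?_
          rw [norm_mul, norm_mul]
      _ ≤ (1 + C) * ‖f' ω - g' ω‖ + ‖f ω - g ω‖ * D :=
          add_le_add (mul_le_mul_of_nonneg_right (hfb ω hω) (norm_nonneg _))
            (mul_le_mul_of_nonneg_left (hb' ω hω) (norm_nonneg _))
      _ < (1 + C) * (ε / (2 * (1 + C))) + (ε / (2 * D)) * D :=
          add_lt_add (mul_lt_mul_of_pos_left (h' ω hω) (by positivity))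
            (mul_lt_mul_of_pos_right (h ω hω) hD)
      _ = ε := by field_simp; ring

end

end DrinfeldDist

end

/-! Fix `ω` and write `e` for the exponential function of `Y_ω`. It is `F`-linear with kernel `Y_ω`,
so `W = e(Y'_ω)` is a finite `F`-space isomorphic to `Y'/Y`. Grouping the product for `Y'_ω` by
cosets of `Y_ω` gives `e^{Y'_ω} = e^W ∘ e` (`expFn_comp`). Since `W` is finite, `φ = e^W` is a
polynomial, equal to `Δ ∏_{w ∈ W} (X - w)`. As `u` runs through the classes over `v`, the difference
`e(vω) - e(uω)` runs once through `W` (`bijOn_classesOver`), so evaluating `φ` at `e(vω)` is the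
distribution relation (`discrFn_mul_finprod_divisionFn`). Comparing linear coefficients gives `Δ
∏_{0 ≠ w ∈ W} w = 1`, which identifies `Δ` with the discriminant of the distribution. The polynomial
is unique because `e` has infinitely many values.

Linearity of `e` comes from finite subspaces: the exponential function of a line is `z - a z^q` by
Wilson's theorem, adjoining one generator at a time yields `q`-polynomials, and `e` is a pointwise
limit of these (`exists_linearMap_eq_expFn`).

All of this needs `Y_ω` to meet each ball in a finite set and `Y'/Y` to be finite. These reduce to
arithmetic of `A`: bounded sets in `A` are finite, proper quotients are finite, and `K` is the
fraction field. The place-theoretic input is proved from one principle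
(`linearIndependent_adjoin_of_mod`): for an `F[t]`-stable subspace `R` of `K`, the dimension of
`R/tR` is at most `[K : F(t)]`. It bounds the number of zeros of `t`, makes valuation rings
noetherian, and gives by a dimension count a nonconstant element of `A`.

Holomorphy follows because the products for `d_u` and for its inverse converge uniformly on each
`Ψ_n` (`exists_units_eq_divisionFn`). -/

open scoped WithZero Polynomial NNReal RatFunc

noncomputable section

namespace DrinfeldDist

/-! ### Subspaces of a function field that are stable under a transcendental element -/

section StableSubspace

variable {F K : Type*} [Field F] [Field K] [Algebra F K]

open IntermediateField IntermediateField.algebraAdjoinAdjoin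

/-- Vectors of an `F[t]`-stable subspace `R` that are `F`-independent modulo `tR` are independent
over `F(t)`. -/
lemma linearIndependent_adjoin_of_mod {t : K} (ht : Transcendental F t) {R : Submodule F K}
    (htR : ∀ x ∈ R, t * x ∈ R) {ι : Type*} [Finite ι] {b : ι → K} (hb : ∀ i, b i ∈ R)
    (hind : LinearIndependent F fun i => (R.map (LinearMap.mulLeft F t)).mkQ (b i)) :
    LinearIndependent F⟮t⟯ b := by
  have := Fintype.ofFinite ι
  have ht0 : t ≠ 0 := by rintro rfl; exact ht (isAlgebraic_zero)
  have haeval : ∀ (p : F[X]), ∀ x ∈ R, Polynomial.aeval t p * x ∈ R := by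
    intro p x hx
    induction p using Polynomial.induction_on' with
    | add p q hp hq => rw [map_add, add_mul]; exact R.add_mem hp hq
    | monomial n a =>
      rw [Polynomial.aeval_monomial, mul_assoc, ← Algebra.smul_def]
      refine R.smul_mem _ ?_
      induction n with
      | zero => simpa
      | succ n ih => rw [pow_succ', mul_assoc]; exact htR _ ih
  -- Descent on the degree: the constant terms form a relation modulo `tR`, hence vanish, after
  -- which `t` can be cancelled from the whole relation.
  have key : ∀ (d : ℕ) (p : ι → F[X]), (∀ i, (p i).natDegree < d) →
      ∑ i, Polynomial.aeval t (p i) * b i = 0 → ∀ i, p i = 0 := by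
    intro d
    induction d with
    | zero => intro p hp _ i; exact absurd (hp i) (Nat.not_lt_zero _)
    | succ d ih =>
      intro p hp hs
      have hdec : ∀ i, Polynomial.aeval t (p i) * b i
          = t * (Polynomial.aeval t (p i).divX * b i) + (p i).coeff 0 • b i := by
        intro i
        conv_lhs => rw [← Polynomial.X_mul_divX_add (p i)]
        rw [map_add, map_mul, Polynomial.aeval_X, Polynomial.aeval_C, Algebra.smul_def]
        ring
      simp_rw [hdec, Finset.sum_add_distrib, ← Finset.mul_sum] at hs
      have hc : ∀ i, (p i).coeff 0 = 0 := by
        refine Fintype.linearIndependent_iff.mp hind (fun i => (p i).coeff 0) ?_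
        simp_rw [← map_smul, ← map_sum]
        rw [Submodule.mkQ_apply, Submodule.Quotient.mk_eq_zero]
        refine ⟨-∑ i, Polynomial.aeval t (p i).divX * b i,
          R.neg_mem (R.sum_mem fun i _ => haeval _ _ (hb i)), ?_⟩
        rw [LinearMap.mulLeft_apply, mul_neg]
        exact neg_eq_of_add_eq_zero_right hs
      have h0 : ∑ i, Polynomial.aeval t (p i).divX * b i = 0 := by
        simpa [hc, ht0] using hs
      have hX : ∀ i, p i = Polynomial.X * (p i).divX := fun i => by
        conv_lhs => rw [← Polynomial.X_mul_divX_add (p i), hc i, map_zero, add_zero]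
      -- For `d = 0` the quotients `divX` do not have degree `< 0`, so the induction hypothesis does
      -- not apply; but then each `p i` is its own, vanishing, constant term.
      rcases Nat.eq_zero_or_pos d with rfl | hd
      · intro i
        have : (p i).natDegree = 0 := by have := hp i; omega
        rw [Polynomial.eq_C_of_natDegree_eq_zero this, hc i, map_zero]
      · intro i
        rw [hX i, ih (fun i => (p i).divX) (fun i => ?_) h0 i, mul_zero]
        rw [Polynomial.natDegree_divX_eq_natDegree_tsub_one]
        have := hp i; omega
  -- Clearing denominators reduces coefficients in `F(t)` to coefficients in `F[t]`.
  rw [← LinearIndependent.iff_fractionRing (Algebra.adjoin F {t}), Fintype.linearIndependent_iff]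
  intro g hg i
  have hp : ∀ i, ∃ p : F[X], Polynomial.aeval t p = (g i : K) := fun i => by
    have := (Algebra.adjoin_singleton_eq_range_aeval F t).le (g i).2
    exact this
  choose p hp using hp
  have := key (Finset.univ.sup (fun i => (p i).natDegree) + 1) p
    (fun i => Nat.lt_succ_of_le (Finset.le_sup (f := fun i => (p i).natDegree) (Finset.mem_univ i)))
    (by simp_rw [hp]; exact hg) i
  apply Subtype.ext
  rw [← hp i, this, map_zero]; rfl

/-- An independent family in `R/tR` lifts to `R`, and the lift is independent over `F(t)`. -/
lemma rank_map_mkQ_le {t : K} (ht : Transcendental F t) [FiniteDimensional F⟮t⟯ K]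
    {R : Submodule F K} (htR : ∀ x ∈ R, t * x ∈ R) :
    Module.rank F (R.map (R.map (LinearMap.mulLeft F t)).mkQ) ≤ Module.finrank F⟮t⟯ K := by
  refine rank_le fun s hs => ?_
  have hl : ∀ i : s, ∃ b ∈ R, (R.map (LinearMap.mulLeft F t)).mkQ b = i.1.1 := fun i => i.1.2
  choose b hb hbi using hl
  have := linearIndependent_adjoin_of_mod ht htR (b := b) hb (by
    simp_rw [hbi]
    exact hs.map' (Submodule.subtype _) (Submodule.ker_subtype _))
  simpa using this.fintype_card_le_finrank

lemma finite_map_mkQ {t : K} (ht : Transcendental F t) [FiniteDimensional F⟮t⟯ K]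
    {R : Submodule F K} (htR : ∀ x ∈ R, t * x ∈ R) :
    Module.Finite F (R.map (R.map (LinearMap.mulLeft F t)).mkQ) :=
  Module.rank_lt_aleph0_iff.mp ((rank_map_mkQ_le ht htR).trans_lt (Cardinal.natCast_lt_aleph0))

lemma finrank_map_mkQ_le {t : K} (ht : Transcendental F t) [FiniteDimensional F⟮t⟯ K]
    {R : Submodule F K} (htR : ∀ x ∈ R, t * x ∈ R) :
    Module.finrank F (R.map (R.map (LinearMap.mulLeft F t)).mkQ) ≤ Module.finrank F⟮t⟯ K :=
  Module.finrank_le_of_rank_le (rank_map_mkQ_le ht htR)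

/-- If `tR ⊊ R₁ ≤ R`, then `R₁` has codimension less than `[K : F(t)]` in `R`. -/
lemma finrank_lt_finrank_inf_add {t : K} (ht : Transcendental F t) [FiniteDimensional F⟮t⟯ K]
    {R R₁ : Submodule F K} (htR : ∀ x ∈ R, t * x ∈ R₁) (hR₁ : R₁ ≤ R) {e : K} (he : e ∈ R₁)
    (he' : ∀ x ∈ R, e ≠ t * x) (W : Submodule F K) [FiniteDimensional F W] (hW : W ≤ R) :
    Module.finrank F W < Module.finrank F (W ⊓ R₁ : Submodule F K) + Module.finrank F⟮t⟯ K := by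
  have htR' : ∀ x ∈ R, t * x ∈ R := fun x hx => hR₁ (htR x hx)
  set S := R.map (LinearMap.mulLeft F t) with hS
  have hSR : S ≤ R₁ := by rintro _ ⟨x, hx, rfl⟩; exact htR x hx
  have := finite_map_mkQ ht htR'
  have h1 := finrank_map_mkQ_le ht htR'
  rw [← hS] at this h1
  -- The map `R/tR → K/R₁` has image `R/R₁` and kills the class of `e`, which is nonzero by `he'`.
  -- Hence `R/R₁` has dimension at most `[K : F(t)] - 1`, and `W/(W ∩ R₁)` embeds into it.
  let f : R.map S.mkQ →ₗ[F] (K ⧸ R₁) := (Submodule.factor hSR).domRestrict _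
  have hker : 0 < Module.finrank F (LinearMap.ker f) := by
    suffices Nontrivial (LinearMap.ker f) from
      Module.finrank_pos (R := F) (M := LinearMap.ker f)
    refine nontrivial_of_ne (⟨⟨S.mkQ e, e, hR₁ he, rfl⟩, ?_⟩ : LinearMap.ker f) 0 ?_
    · rw [LinearMap.mem_ker]
      change Submodule.factor hSR (S.mkQ e) = 0
      simpa using he
    · intro h
      have : S.mkQ e = 0 := congrArg (fun x => x.1.1) h
      rw [Submodule.mkQ_apply, Submodule.Quotient.mk_eq_zero] at this
      obtain ⟨x, hx, h⟩ := this
      exact he' x hx h.symm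
  have hrange : W.map R₁.mkQ ≤ LinearMap.range f := by
    rintro _ ⟨w, hw, rfl⟩
    exact ⟨⟨S.mkQ w, w, hW hw, rfl⟩, by
      change Submodule.factor hSR (S.mkQ w) = _
      simp⟩
  have h2 := LinearMap.finrank_range_add_finrank_ker f
  have h3 := Submodule.finrank_mono hrange
  have h4 := LinearMap.finrank_range_add_finrank_ker (R₁.mkQ.domRestrict W)
  have h5 : LinearMap.range (R₁.mkQ.domRestrict W) = W.map R₁.mkQ := by
    rw [LinearMap.domRestrict, LinearMap.range_comp, Submodule.range_subtype]
  have h6 : Module.finrank F (LinearMap.ker (R₁.mkQ.domRestrict W))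
      ≤ Module.finrank F (W ⊓ R₁ : Submodule F K) := by
    have : (LinearMap.ker (R₁.mkQ.domRestrict W)).map W.subtype ≤ W ⊓ R₁ := by
      rintro _ ⟨x, hx, rfl⟩
      refine ⟨x.2, ?_⟩
      have hx' : R₁.mkQ x.1 = 0 := hx
      simpa using hx'
    refine le_trans (le_of_eq ?_) (Submodule.finrank_mono this)
    exact (Submodule.finrank_map_subtype_eq _ _).symm
  rw [h5] at h4
  omega

end StableSubspace

/-! ### Places of a function field -/

lemma valuation_le_one_of_isIntegral {R K Γ : Type*} [CommRing R] [Field K] [Algebra R K]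
    [LinearOrderedCommGroupWithZero Γ] (v : Valuation K Γ)
    (hv : ∀ r : R, v (algebraMap R K r) ≤ 1) {x : K} (hx : IsIntegral R x) : v x ≤ 1 := by
  refine (Valuation.integer.integers v).mem_of_integral (x := x) ?_
  exact IsIntegral.map_of_comp_eq
    ((algebraMap R K).codRestrict v.integer hv) (RingHom.id K) (by ext; rfl) hx

namespace Place

variable {K : Type*} [Field K]

/-- The hypothesis makes `Q.v` a power of `P.v` with some exponent `k`. Both valuations are
normalized, that is, surjective, so `k` divides `1`, and it is positive. -/
lemma eq_of_lt_one_iff {P Q : Place K} (h : ∀ x, P.v x < 1 ↔ Q.v x < 1) : P = Q := by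
  have h1 : ∀ x, P.v x = 1 → Q.v x = 1 := by
    intro x hx
    have hx0 : x ≠ 0 := by rintro rfl; simp at hx
    refine le_antisymm (not_lt.mp fun hlt => ?_) (not_lt.mp fun hlt => ?_)
    · have : P.v x⁻¹ < 1 := (h _).mpr (by rw [map_inv₀]; exact inv_lt_one_of_one_lt₀ hlt)
      rw [map_inv₀, hx, inv_one] at this
      exact this.false
    · exact ((h x).mpr hlt).ne hx
  obtain ⟨π, hπ⟩ := P.surjective (WithZero.exp 1)
  have hπ0 : π ≠ 0 := by
    rintro rfl; rw [map_zero] at hπ; exact WithZero.exp_ne_zero hπ.symm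
  obtain ⟨k, hk⟩ : ∃ k : ℤ, Q.v π = WithZero.exp k :=
    ⟨_, (WithZero.exp_log ((map_ne_zero _).mpr hπ0)).symm⟩
  have hpow : ∀ (x : K) (n : ℤ), P.v x = WithZero.exp n → Q.v x = WithZero.exp (n * k) := by
    intro x n hx
    have h' : P.v (x / π ^ n) = 1 := by
      rw [map_div₀, map_zpow₀, hx, hπ, ← WithZero.exp_zsmul, smul_eq_mul, mul_one]
      exact div_self WithZero.exp_ne_zero
    have := h1 _ h'
    rw [map_div₀, map_zpow₀, hk, ← WithZero.exp_zsmul, smul_eq_mul] at this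
    exact (div_eq_one_iff_eq WithZero.exp_ne_zero).mp this
  obtain ⟨x, hx⟩ := Q.surjective (WithZero.exp 1)
  have hx0 : x ≠ 0 := by
    rintro rfl; rw [map_zero] at hx; exact WithZero.exp_ne_zero hx.symm
  have hn := hpow x _ (WithZero.exp_log ((map_ne_zero _).mpr hx0)).symm
  rw [hx, WithZero.exp_inj] at hn
  have hk0 : 0 < k := by
    have : Q.v π⁻¹ < 1 := (h _).mp (by
      rw [map_inv₀, hπ, ← WithZero.exp_neg, ← WithZero.exp_zero, WithZero.exp_lt_exp]; omega)
    rw [map_inv₀, hk, ← WithZero.exp_neg, ← WithZero.exp_zero, WithZero.exp_lt_exp] at this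
    omega
  have hk1 : k = 1 := by
    have hdvd : k ∣ 1 := ⟨_, by rw [mul_comm]; exact hn⟩
    exact Int.eq_one_of_dvd_one hk0.le hdvd
  have hv : P.v = Q.v := by
    ext x
    by_cases hx : x = 0
    · simp [hx]
    · have := hpow x _ (WithZero.exp_log ((map_ne_zero _).mpr hx)).symm
      rw [this, hk1, mul_one, WithZero.exp_log ((map_ne_zero _).mpr hx)]
  cases P; cases Q; congr

lemma absVal_apply (P : Place K) (x : K) :
    P.absVal x = (WithZeroMulInt.toNNReal (ne_zero_of_lt P.one_lt_qInf) (P.v x) : ℝ) := rfl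

lemma absVal_lt_iff (P : Place K) (x y : K) : P.absVal x < P.absVal y ↔ P.v x < P.v y := by
  rw [absVal_apply, absVal_apply, NNReal.coe_lt_coe]
  exact (WithZeroMulInt.toNNReal_strictMono P.one_lt_qInf).lt_iff_lt

lemma absVal_le_iff (P : Place K) (x y : K) : P.absVal x ≤ P.absVal y ↔ P.v x ≤ P.v y := by
  rw [← not_lt, absVal_lt_iff, not_lt]

lemma absVal_lt_one_iff (P : Place K) (x : K) : P.absVal x < 1 ↔ P.v x < 1 := by
  simpa using P.absVal_lt_iff x 1

lemma one_lt_absVal_iff (P : Place K) (x : K) : 1 < P.absVal x ↔ 1 < P.v x := by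
  simpa using P.absVal_lt_iff 1 x

/-- Distinct places are separated by an element of the intersection of the valuation rings. -/
lemma exists_eq_one_lt_one (s : Finset (Place K)) {P : Place K} (hP : P ∈ s) :
    ∃ b : K, P.v b = 1 ∧ ∀ w ∈ s, w ≠ P → w.v b < 1 := by
  obtain ⟨a, ha, ha'⟩ := AbsoluteValue.exists_one_lt_lt_one_pi_of_not_isEquiv
    (v := fun w : s => w.1.absVal)
    (fun w => by
      obtain ⟨x, hx⟩ := w.1.surjective (WithZero.exp 1)
      have h1 : 1 < w.1.v x := by
        rw [hx, ← WithZero.exp_zero, WithZero.exp_lt_exp]; exact one_pos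
      refine ⟨x, fun h => ?_, ((w.1.one_lt_absVal_iff x).mpr h1).ne'⟩
      rw [h, map_zero] at h1
      exact not_lt_zero h1)
    (fun w w' hne h => hne (Subtype.ext (eq_of_lt_one_iff fun x => by
      rw [← absVal_lt_one_iff, ← absVal_lt_one_iff]; exact h.lt_one_iff))) ⟨P, hP⟩
  rw [one_lt_absVal_iff] at ha
  have h1 : P.v (1 + a) = P.v a := P.v.map_add_eq_of_lt_right (by rwa [map_one])
  -- Weak approximation gives `a` large at `P` and small at the other places of `s`. Then `1 + a`
  -- has the value of `a` at `P` and the value `1` elsewhere.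
  refine ⟨a / (1 + a), ?_, fun w hw hne => ?_⟩
  · rw [map_div₀, h1, div_self (zero_lt_one.trans ha).ne']
  · have h := (absVal_lt_one_iff _ _).mp (ha' ⟨w, hw⟩ (fun h => hne (congrArg Subtype.val h)))
    have h2 : w.v (1 + a) = w.v 1 := w.v.map_add_eq_of_lt_left (by rwa [map_one])
    rw [map_div₀, h2, map_one, div_one]
    exact h

section FiniteConstants

variable {F : Type*} [Field F] [Finite F] [Algebra F K]

lemma v_algebraMap (P : Place K) {c : F} (hc : c ≠ 0) : P.v (algebraMap F K c) = 1 := by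
  have hfin : IsOfFinOrder (Units.mk0 c hc) := isOfFinOrder_of_finite _
  obtain ⟨n, hn, h⟩ := isOfFinOrder_iff_pow_eq_one.mp hfin
  have h' : c ^ n = 1 := by simpa [Units.ext_iff] using h
  have : P.v (algebraMap F K c) ^ n = 1 := by rw [← map_pow, ← map_pow, h', map_one, map_one]
  exact (pow_eq_one_iff_of_nonneg zero_le hn.ne').mp this

lemma v_algebraMap_le (P : Place K) (c : F) : P.v (algebraMap F K c) ≤ 1 := by
  by_cases hc : c = 0
  · simp [hc]
  · exact (P.v_algebraMap hc).le

lemma v_smul (P : Place K) {c : F} (hc : c ≠ 0) (x : K) : P.v (c • x) = P.v x := by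
  rw [Algebra.smul_def, map_mul, P.v_algebraMap hc, one_mul]

lemma v_le_one_of_isAlgebraic (P : Place K) {x : K} (hx : IsAlgebraic F x) : P.v x ≤ 1 :=
  valuation_le_one_of_isIntegral P.v P.v_algebraMap_le hx.isIntegral

lemma transcendental_of_lt_one (P : Place K) {x : K} (hx0 : x ≠ 0) (hx : P.v x < 1) :
    Transcendental F x := fun h => by
  have := P.v_le_one_of_isAlgebraic h.inv
  rw [map_inv₀] at this
  exact this.not_gt ((one_lt_inv₀ ((Valuation.pos_iff _).mpr hx0)).mpr hx)

variable (F) in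
/-- The `F`-subspace of elements of valuation at most `γ`. -/
def ball (P : Place K) (γ : ℤᵐ⁰) : Submodule F K where
  carrier := {x | P.v x ≤ γ}
  add_mem' {x y} hx hy := (P.v.map_add x y).trans (max_le hx hy)
  zero_mem' := by simp
  smul_mem' c x hx := by
    by_cases hc : c = 0
    · simp [hc]
    · change P.v _ ≤ γ; rw [P.v_smul hc]; exact hx

lemma mem_ball {P : Place K} {γ : ℤᵐ⁰} {x : K} : x ∈ P.ball F γ ↔ P.v x ≤ γ := Iff.rfl

open IntermediateField

/-- Let `R` consist of the elements integral at all places of `s`. Separating elements `b w` lie in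
`R` and are independent modulo `tR`: a combination with nonzero coefficient at `b w` has value `1`
at `w`, whereas all of `tR` has value `< 1` there. -/
lemma card_le_of_lt_one {t : K} (ht : Transcendental F t)
    [FiniteDimensional F⟮t⟯ K] (s : Finset (Place K)) (hs : ∀ w ∈ s, w.v t < 1) :
    s.card ≤ Module.finrank F⟮t⟯ K := by
  classical
  choose b hb hb' using fun w : s => exists_eq_one_lt_one s w.2
  let R : Submodule F K := ⨅ w : s, w.1.ball F 1
  have hR : ∀ x, x ∈ R ↔ ∀ w : s, w.1.v x ≤ 1 := fun x => by
    simp only [R, Submodule.mem_iInf]; rfl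
  have := linearIndependent_adjoin_of_mod ht (R := R) (b := b)
    (fun x hx => (hR _).mpr fun w => by
      rw [map_mul]; exact mul_le_one' (hs _ w.2).le ((hR _).mp hx w))
    (fun w => (hR _).mpr fun w' => by
      by_cases h : w' = w
      · rw [h, hb]
      · exact (hb' w _ w'.2 (fun h' => h (Subtype.ext h'))).le)
    (by
      rw [Fintype.linearIndependent_iff]
      intro c hc w
      simp_rw [← map_smul, ← map_sum] at hc
      rw [Submodule.mkQ_apply, Submodule.Quotient.mk_eq_zero] at hc
      obtain ⟨y, hy, hc⟩ := hc
      rw [LinearMap.mulLeft_apply] at hc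
      by_contra hcw
      have h1 : w.1.v (t * y) < 1 := by
        rw [map_mul]
        exact mul_lt_one_of_lt_of_le (hs _ w.2) ((hR _).mp hy w)
      rw [hc, ← Finset.add_sum_erase _ _ (Finset.mem_univ w)] at h1
      have h2 : w.1.v (∑ x ∈ Finset.univ.erase w, c x • b x) < 1 := by
        refine Valuation.map_sum_lt _ one_ne_zero fun i hi => ?_
        by_cases hci : c i = 0
        · simp [hci]
        · rw [v_smul _ hci]
          exact hb' i _ w.2 (fun h => (Finset.mem_erase.mp hi).1 (Subtype.ext h.symm))
      have h3 : w.1.v (c w • b w) = 1 := by rw [v_smul _ hcw, hb]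
      rw [Valuation.map_add_eq_of_lt_left _ (by rwa [h3]), h3] at h1
      exact h1.false)
  simpa using this.fintype_card_le_finrank

lemma finite_lt_one {t : K} (ht : Transcendental F t)
    [FiniteDimensional F⟮t⟯ K] : {w : Place K | w.v t < 1}.Finite := by
  by_contra h
  obtain ⟨s, hs, hcard⟩ := Set.Infinite.exists_subset_card_eq h (Module.finrank F⟮t⟯ K + 1)
  have := card_le_of_lt_one ht s (fun w hw => hs hw)
  omega


end FiniteConstants

end Place

/-! ### Existence of places: nonconstant elements have poles -/

section Existence

variable {F K : Type*} [Field F] [Finite F] [Field K] [Algebra F K]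
open IntermediateField

/-- A valuation ring of `K` containing the constants is noetherian. -/
lemma isNoetherianRing_valuationSubring
    (hfd : ∀ t : K, Transcendental F t → FiniteDimensional F⟮t⟯ K)
    (V : ValuationSubring K) (hV : ∀ c : F, algebraMap F K c ∈ V) : IsNoetherianRing V := by
  have hint : ∀ x : K, IsIntegral F x → x ∈ V := fun x hx => by
    rw [← V.valuation_le_one_iff]
    exact valuation_le_one_of_isIntegral V.valuation
      (fun c => (V.valuation_le_one_iff _).mpr (hV c)) hx
  let R : Submodule F K :=
    { carrier := V
      add_mem' := V.add_mem _ _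
      zero_mem' := V.zero_mem
      smul_mem' := fun c x hx => by
        rw [Algebra.smul_def]; exact V.mul_mem _ _ (hV c) hx }
  -- Cohen's criterion: only nonzero primes need to be finitely generated. For `0 ≠ t` in such a
  -- prime `I`, the quotient `V/tV` is finite, so `I` is generated by `t` and representatives of the
  -- finitely many classes of `I` modulo `t`.
  refine IsNoetherianRing.of_prime_ne_bot fun I hI hI0 => ?_
  obtain ⟨t, htI, ht0⟩ := Submodule.exists_mem_ne_zero_of_ne_bot hI0
  have htK : (t : K) ≠ 0 := fun h => ht0 (Subtype.ext h)
  have httr : Transcendental F (t : K) := fun halg => by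
    refine hI.ne_top (Ideal.eq_top_of_isUnit_mem _ htI ?_)
    refine IsUnit.of_mul_eq_one (⟨(t : K)⁻¹, hint _ halg.inv.isIntegral⟩ : V) (Subtype.ext ?_)
    exact mul_inv_cancel₀ htK
  have := hfd _ httr
  have hfin := finite_map_mkQ httr (R := R) (fun x hx => V.mul_mem _ _ t.2 hx)
  have hfin' := Module.finite_of_finite F (M := R.map (R.map (LinearMap.mulLeft F (t : K))).mkQ)
  obtain ⟨s, hsI, hs⟩ := Set.exists_subset_bijOn (I : Set V)
    (fun y : V => (R.map (LinearMap.mulLeft F (t : K))).mkQ y)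
  have hsfin : s.Finite := by
    rw [hs.finite_iff_finite]
    refine (Set.toFinite (R.map (R.map (LinearMap.mulLeft F (t : K))).mkQ : Set _)).subset ?_
    rintro _ ⟨y, _, rfl⟩
    exact ⟨y, y.2, rfl⟩
  have hspan : I = Ideal.span (insert t s) := by
    refine le_antisymm (fun y hy => ?_)
      (Ideal.span_le.mpr (Set.insert_subset htI hsI))
    obtain ⟨y', hy', h⟩ := hs.surjOn ⟨y, hy, rfl⟩
    have h' := (Submodule.Quotient.eq _).mp h
    obtain ⟨z, hz, hzy⟩ := h'
    have : y = y' - ⟨z, hz⟩ * t := by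
      apply Subtype.ext
      have hzy' : (t : K) * z = (y' : K) - y := hzy
      push_cast
      rw [mul_comm z, hzy']; ring
    rw [this]
    exact Ideal.sub_mem _ (Ideal.subset_span (Set.mem_insert_of_mem _ hy'))
      (Ideal.mul_mem_left _ _ (Ideal.subset_span (Set.mem_insert _ _)))
  rw [hspan]
  exact Submodule.fg_span (hsfin.insert t)

/-- Every nonconstant element of a function field has a pole. -/
lemma exists_place_one_lt (hfd : ∀ t : K, Transcendental F t → FiniteDimensional F⟮t⟯ K)
    {x : K} (hx : Transcendental F x) : ∃ w : Place K, 1 < w.v x := by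
  have hxR : x ∉ (integralClosure F K).toSubring := fun h => hx h.isAlgebraic
  have hcl : IsIntegrallyClosedIn (integralClosure F K).toSubring K :=
    inferInstanceAs (IsIntegrallyClosedIn (integralClosure F K) K)
  -- An integrally closed subring is an intersection of valuation rings, so one of them misses `x`.
  -- Being noetherian, it is discrete, and its normalized valuation is the desired place.
  obtain ⟨V, hRV, hxV⟩ := Subring.exists_le_valuationSubring_of_isIntegrallyClosedIn hxR
  have := isNoetherianRing_valuationSubring hfd V
    (fun c => hRV ((integralClosure F K).algebraMap_mem c))
  have hx0 : x ≠ 0 := by rintro rfl; exact hxV V.zero_mem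
  have hxi : x⁻¹ ∈ V := (V.mem_or_inv_mem x).resolve_left hxV
  have hmem : (⟨x⁻¹, hxi⟩ : V) ∈ IsLocalRing.maximalIdeal V := by
    rw [IsLocalRing.mem_maximalIdeal, mem_nonunits_iff]
    intro h
    obtain ⟨y, hy⟩ := h.exists_right_inv
    have : x⁻¹ * (y : K) = 1 := congrArg Subtype.val hy
    exact hxV (by rw [← inv_inv x, inv_eq_of_mul_eq_one_right this]; exact y.2)
  let 𝔪 : IsDedekindDomain.HeightOneSpectrum V :=
    ⟨IsLocalRing.maximalIdeal V, inferInstance, fun h => by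
      rw [h, Ideal.mem_bot] at hmem
      exact inv_ne_zero hx0 (congrArg Subtype.val hmem)⟩
  refine ⟨⟨𝔪.valuation K, 𝔪.valuation_surjective K⟩, ?_⟩
  have h := (𝔪.valuation_lt_one_iff_mem (K := K) ⟨x⁻¹, hxi⟩).mpr hmem
  change 𝔪.valuation K x⁻¹ < 1 at h
  rw [map_inv₀] at h
  exact (inv_lt_one₀ ((Valuation.pos_iff _).mpr hx0)).mp h

end Existence

/-! ### The coefficient ring -/

section CoeffRing

variable {F K : Type*} [Field F] [Field K] [Algebra F K]
open IntermediateField IntermediateField.algebraAdjoinAdjoin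

lemma linearIndependent_pow_of_transcendental {x : K} (hx : Transcendental F x) :
    LinearIndependent F fun n : ℕ => x ^ n := by
  have h := (Polynomial.basisMonomials F).linearIndependent.map'
    (Polynomial.aeval (R := F) x).toLinearMap
    (LinearMap.ker_eq_bot.mpr (transcendental_iff_injective.mp hx))
  have h2 : (fun n : ℕ => x ^ n) = (Polynomial.aeval (R := F) x).toLinearMap ∘
      Polynomial.basisMonomials F := by
    ext n
    simp [Polynomial.aeval_monomial]
  rw [h2]
  exact h

/-- Used to choose exponents uniformly over finitely many places: a high power of an element
vanishing there absorbs any given pole. -/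
lemma exists_forall_pow_mul_le {ι : Type*} (s : Finset ι) (a b c : ι → ℤᵐ⁰)
    (ha : ∀ i ∈ s, a i < 1) (hc : ∀ i ∈ s, c i ≠ 0) :
    ∃ n : ℕ, ∀ m ≥ n, ∀ i ∈ s, a i ^ m * b i ≤ c i := by
  have : ∀ i ∈ s, ∃ n : ℕ, ∀ m ≥ n, a i ^ m * b i ≤ c i := by
    intro i hi
    rcases eq_or_ne (b i) 0 with hb | hb
    · exact ⟨0, fun m _ => by simp [hb]⟩
    obtain ⟨n, hn⟩ := exists_pow_lt₀ (ha i hi) (Units.mk0 (c i / b i) (div_ne_zero (hc i hi) hb))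
    refine ⟨n, fun m hm => ?_⟩
    have h1 : a i ^ m ≤ c i / b i := (pow_le_pow_of_le_one zero_le (ha i hi).le hm).trans hn.le
    rwa [le_div_iff₀ (zero_lt_iff.mpr hb)] at h1
  choose! n hn using this
  exact ⟨s.sup n, fun m hm i hi => hn i hi m ((Finset.le_sup hi).trans hm)⟩

/-- Each step of the filtration costs at most `[K : F(t)] - 1` dimensions. The gain of `1` over the
trivial bound, due to `e j`, is what makes the dimension count for a nonconstant element of `A`
succeed. -/
lemma finrank_le_finrank_inf_add_mul {t : K} (ht : Transcendental F t)
    [FiniteDimensional F⟮t⟯ K] {R : ℕ → Submodule F K} (hmono : ∀ j, R (j + 1) ≤ R j)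
    (hmul : ∀ j, ∀ x ∈ R j, t * x ∈ R (j + 1)) {e : ℕ → K} (he : ∀ j, e j ∈ R (j + 1))
    (he' : ∀ j, ∀ x ∈ R j, e j ≠ t * x) (W : Submodule F K) [FiniteDimensional F W]
    (hW : W ≤ R 0) (j : ℕ) :
    Module.finrank F W ≤
      Module.finrank F (W ⊓ R j : Submodule F K) + j * (Module.finrank F⟮t⟯ K - 1) := by
  induction j with
  | zero => rw [inf_eq_left.mpr hW, zero_mul, add_zero]
  | succ j ih =>
    have : FiniteDimensional F (W ⊓ R j : Submodule F K) :=
      Submodule.finiteDimensional_of_le (S₂ := W) inf_le_left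
    have h := finrank_lt_finrank_inf_add ht (hmul j) (hmono j) (he j) (he' j) (W ⊓ R j)
      inf_le_right
    rw [inf_assoc, inf_eq_right.mpr (hmono j)] at h
    rw [Nat.succ_mul]
    omega

variable [Finite F]

/-- A basis of `K` over `F(t)` consisting of elements that are integral at the places where `t`
has no zero. -/
lemma exists_linearIndependent_le_one (t : K)
    [FiniteDimensional F⟮t⟯ K] :
    ∃ β : Fin (Module.finrank F⟮t⟯ K) → K, LinearIndependent F⟮t⟯ β ∧
      ∀ w : Place K, 1 ≤ w.v t → ∀ i, w.v (β i) ≤ 1 := by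
  have hinv : F⟮t⁻¹⟯ = F⟮t⟯ := by
    refine le_antisymm ?_ ?_ <;> rw [adjoin_simple_le_iff]
    · exact inv_mem (mem_adjoin_simple_self F t)
    · simpa using inv_mem (mem_adjoin_simple_self F t⁻¹)
  rw [← hinv]
  have : FiniteDimensional F⟮t⁻¹⟯ K := hinv ▸ ‹FiniteDimensional F⟮t⟯ K›
  -- Integrality is taken over `F[1/t]`, since `1/t` is regular at the places with `v(t) ≥ 1`.
  obtain ⟨s, b, hb⟩ := FiniteDimensional.exists_is_basis_integral
    (Algebra.adjoin F {t⁻¹}) F⟮t⁻¹⟯ K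
  let e : Fin (Module.finrank F⟮t⁻¹⟯ K) ≃ s := (finCongr
    (by rw [Module.finrank_eq_card_basis b])).trans (Fintype.equivFin s).symm
  refine ⟨b ∘ e, b.linearIndependent.comp _ e.injective, fun w hw i => ?_⟩
  refine valuation_le_one_of_isIntegral w.v (fun r => ?_) (hb (e i))
  obtain ⟨r, hr⟩ := r
  change w.v r ≤ 1
  induction hr using Algebra.adjoin_induction with
  | mem x hx => rw [hx, map_inv₀]; exact inv_le_one_of_one_le₀ hw
  | algebraMap c => exact w.v_algebraMap_le c
  | add x y _ _ hx hy => exact (w.v.map_add x y).trans (max_le hx hy)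
  | mul x y _ _ hx hy => rw [map_mul]; exact mul_le_one' hx hy

set_option maxHeartbeats 1000000 in
/-- The ring `A` contains nonconstant elements. -/
lemma exists_transcendental_mem_coeffRing
    (hfd : ∀ t : K, Transcendental F t → FiniteDimensional F⟮t⟯ K)
    (hF : ∀ x : K, IsAlgebraic F x → x ∈ Set.range (algebraMap F K)) (P : Place K) :
    ∃ a ∈ P.coeffRing, Transcendental F a := by
  classical
  obtain ⟨t, hPt⟩ := P.surjective (WithZero.exp (-1))
  have ht0 : t ≠ 0 := by
    rintro rfl; rw [map_zero] at hPt; exact WithZero.exp_ne_zero hPt.symm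
  have hPt1 : P.v t < 1 := by
    rw [hPt, ← WithZero.exp_zero, WithZero.exp_lt_exp]; omega
  have ht := P.transcendental_of_lt_one (F := F) ht0 hPt1
  have := hfd t ht
  set N := Module.finrank F⟮t⟯ K with hN
  have hNpos : 0 < N := Module.finrank_pos
  have hTfin := Place.finite_lt_one ht
  set T := hTfin.toFinset with hT
  have hmemT : ∀ w, w ∈ T ↔ w.v t < 1 := fun w => by simp [hT]
  obtain ⟨b, hPb, hb⟩ := Place.exists_eq_one_lt_one T ((hmemT P).mpr hPt1)
  -- Thus `b ^ M` is a unit at `P` and divisible by `t` at every other zero of `t`. Its powers lie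
  -- in the filtration `R` but are never `t` times an element of the preceding step.
  obtain ⟨M, hM⟩ := exists_forall_pow_mul_le (T.erase P) (fun w => w.v b) (fun _ => 1)
    (fun w => w.v t) (fun w hw => hb w (Finset.mem_of_mem_erase hw) (Finset.ne_of_mem_erase hw))
    (fun w _ => (map_ne_zero _).mpr ht0)
  obtain ⟨β, hβ, hβ1⟩ := exists_linearIndependent_le_one (F := F) t
  obtain ⟨c, hc⟩ := exists_forall_pow_mul_le (T ×ˢ (Finset.univ : Finset (Fin N)))
    (fun p => p.1.v t) (fun p => p.1.v (β p.2)) (fun _ => 1)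
    (fun p hp => (hmemT _).mp (Finset.mem_product.mp hp).1) (fun _ _ => one_ne_zero)
  -- Integral at `P`, and divisible by `t ^ j` at all other zeros of `t`. Division by `t ^ j`
  -- therefore creates a pole at no zero of `t` except possibly `P`.
  let R : ℕ → Submodule F K := fun j => P.ball F 1 ⊓ ⨅ w : T.erase P, w.1.ball F (w.1.v t ^ j)
  have hR : ∀ j x, x ∈ R j ↔ P.v x ≤ 1 ∧ ∀ w ∈ T, w ≠ P → w.v x ≤ w.v t ^ j := by
    intro j x
    simp only [R, Submodule.mem_inf, Submodule.mem_iInf, Place.mem_ball, Subtype.forall,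
      Finset.mem_erase, and_imp]
    exact and_congr_right fun _ => forall_congr' fun w => forall_comm
  -- With `k = m + c`, the count is `(m + 1) N - k (N - 1) = N + m - c (N - 1) = N + c + 1 ≥ 2`. The
  -- exponent `k` is also the largest power of `t` occurring in `W`, so dividing by `t ^ k` removes
  -- the poles of `W` outside the zeros of `t`.
  let m := c * N + 1
  let k := m + c
  let g : Fin (m + 1) × Fin N → K := fun p => t ^ (c + p.1.1) * β p.2
  have hg : LinearIndependent F g := by
    have h1 : LinearIndependent F fun j : Fin (m + 1) => (AdjoinSimple.gen F t) ^ (c + j.1) := by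
      refine LinearIndependent.of_comp (F⟮t⟯.val.toLinearMap) ?_
      exact (linearIndependent_pow_of_transcendental ht).comp (fun j : Fin (m + 1) => c + j.1)
        (fun i j h => Fin.ext (by simpa using h))
    exact linearIndependent_smul h1 hβ
  set W := Submodule.span F (Set.range g) with hW
  have hWfin : FiniteDimensional F W := FiniteDimensional.span_of_finite F (Set.finite_range g)
  have hWdim : Module.finrank F W = (m + 1) * N := by
    rw [finrank_span_eq_card hg]; simp
  have hgT : ∀ w ∈ T, ∀ p, w.v (g p) ≤ 1 := fun w hw p => by
    rw [map_mul, map_pow]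
    exact hc _ (Nat.le_add_right _ _) (w, p.2) (by simp [hw])
  have hW0 : W ≤ R 0 := Submodule.span_le.mpr (by
    rintro _ ⟨p, rfl⟩
    refine (hR _ _).mpr ⟨hgT P ((hmemT P).mpr hPt1) p, fun w hw _ => ?_⟩
    rw [pow_zero]; exact hgT w hw p)
  have hmono : ∀ j, R (j + 1) ≤ R j := fun j x hx => by
    obtain ⟨h1, h2⟩ := (hR _ _).mp hx
    exact (hR _ _).mpr ⟨h1, fun w hw hne => (h2 w hw hne).trans
      (pow_le_pow_of_le_one zero_le ((hmemT w).mp hw).le (Nat.le_succ j))⟩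
  have hmul : ∀ j, ∀ x ∈ R j, t * x ∈ R (j + 1) := fun j x hx => by
    obtain ⟨h1, h2⟩ := (hR _ _).mp hx
    refine (hR _ _).mpr ⟨?_, fun w hw hne => ?_⟩
    · rw [map_mul]; exact mul_le_one' hPt1.le h1
    · rw [map_mul, pow_succ']; exact mul_le_mul_right (h2 w hw hne) _
  have he1 : ∀ j, (b ^ M) ^ (j + 1) ∈ R (j + 1) := fun j =>
    (hR _ _).mpr ⟨by rw [map_pow, map_pow, hPb, one_pow, one_pow], fun w hw hne => by
      rw [map_pow, map_pow]
      refine pow_le_pow_left₀ zero_le ?_ _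
      have := hM M le_rfl w (Finset.mem_erase.mpr ⟨hne, hw⟩)
      rwa [mul_one] at this⟩
  have he2 : ∀ j, ∀ x ∈ R j, (b ^ M) ^ (j + 1) ≠ t * x := fun j x hx heq => by
    have h1 : P.v ((b ^ M) ^ (j + 1)) < 1 := by
      rw [heq, map_mul]
      exact mul_lt_one_of_lt_of_le hPt1 ((hR _ _).mp hx).1
    rw [map_pow, map_pow, hPb, one_pow, one_pow] at h1
    exact h1.false
  have hk := finrank_le_finrank_inf_add_mul ht hmono hmul he1 he2 W hW0 k
  rw [← hN] at hk
  have h2 : 2 ≤ Module.finrank F (W ⊓ R k : Submodule F K) := by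
    rw [hWdim] at hk
    obtain ⟨n, hn⟩ : ∃ n, N = n + 1 := ⟨N - 1, by omega⟩
    rw [hn, Nat.add_sub_cancel] at hk
    have hm : m = c * (n + 1) + 1 := by simp only [m, hn]
    have hk' : k = m + c := rfl
    rw [hk', hm] at hk ⊢
    nlinarith
  -- Dimension at least two leaves room for a `y` with `y / t ^ k` nonconstant.
  obtain ⟨y, ⟨hyW, hyR⟩, hy⟩ : ∃ y ∈ W ⊓ R k, y ∉ Submodule.span F {t ^ k} := by
    by_contra! h
    have := (Submodule.finrank_mono (show W ⊓ R k ≤ _ from h)).trans (finrank_span_le_card _)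
    simp at this
    omega
  have htk : t ^ k ≠ 0 := pow_ne_zero _ ht0
  refine ⟨y / t ^ k, fun w hw => ?_, fun halg => ?_⟩
  · rw [map_div₀, map_pow]
    refine div_le_one_of_le₀ ?_ zero_le
    by_cases hwT : w ∈ T
    · exact ((hR _ _).mp hyR).2 w hwT hw
    · have h1 : 1 ≤ w.v t := not_lt.mp (fun h => hwT ((hmemT w).mpr h))
      have : W ≤ w.ball F (w.v t ^ k) := Submodule.span_le.mpr (by
        rintro _ ⟨p, rfl⟩
        change w.v (t ^ (c + p.1.1) * β p.2) ≤ _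
        rw [map_mul, map_pow]
        refine (mul_le_of_le_one_right zero_le (hβ1 w h1 _)).trans (pow_le_pow_right₀ h1 ?_)
        have := p.1.2
        omega)
      exact this hyW
  · obtain ⟨d, hd⟩ := hF _ halg
    refine hy (Submodule.mem_span_singleton.mpr ⟨d, ?_⟩)
    rw [Algebra.smul_def, hd, div_mul_cancel₀ _ htk]

end CoeffRing

/-! ### Fractions, bounded elements and quotients of the coefficient ring -/

section CoeffRingFiniteness

variable {F K : Type*} [Field F] [Finite F] [Field K] [Algebra F K]
open IntermediateField

lemma algebraMap_mem_coeffRing (P : Place K) (c : F) : algebraMap F K c ∈ P.coeffRing :=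
  fun w _ => w.v_algebraMap_le c

lemma mem_coeffRing_of_isIntegral {K : Type*} [Field K] (P : Place K) {x : K}
    (hx : IsIntegral P.coeffRing x) : x ∈ P.coeffRing :=
  fun w hw => valuation_le_one_of_isIntegral w.v (fun r => r.2 w hw) hx

variable (F) in
/-- The ring `A` as a subspace of `K` over the field of constants. -/
def coeffSubmodule (P : Place K) : Submodule F K where
  carrier := P.coeffRing
  add_mem' := P.coeffRing.add_mem
  zero_mem' := P.coeffRing.zero_mem
  smul_mem' c x hx := by
    rw [Algebra.smul_def]
    exact P.coeffRing.mul_mem (algebraMap_mem_coeffRing P c) hx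

/-- The field `K` is the field of fractions of `A`. -/
lemma exists_mul_mem_coeffRing
    (hfd : ∀ t : K, Transcendental F t → FiniteDimensional F⟮t⟯ K)
    (hF : ∀ x : K, IsAlgebraic F x → x ∈ Set.range (algebraMap F K)) (P : Place K) (x : K) :
    ∃ a ∈ P.coeffRing, a ≠ 0 ∧ a * x ∈ P.coeffRing := by
  obtain ⟨t, htA, ht⟩ := exists_transcendental_mem_coeffRing hfd hF P
  have := hfd t ht
  let S : Subalgebra F K :=
    { P.coeffRing with algebraMap_mem' := algebraMap_mem_coeffRing P }
  have hle : (Algebra.adjoin F {t}).toSubring ≤ P.coeffRing := fun y hy =>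
    (Algebra.adjoin_le (S := S) (Set.singleton_subset_iff.mpr htA)) hy
  -- Some nonzero multiple `a x` with `a ∈ F[t] ⊆ A` is integral over `F[t]`, and `A` is integrally
  -- closed in `K`.
  have halg : IsAlgebraic (Algebra.adjoin F {t}) x :=
    isAlgebraic_adjoin_iff.mp (Algebra.IsAlgebraic.isAlgebraic (R := F⟮t⟯) x)
  obtain ⟨a, ha0, ha⟩ := halg.exists_integral_multiple
  refine ⟨a, hle a.2, fun h => ha0 (Subtype.ext h), mem_coeffRing_of_isIntegral P ?_⟩
  exact IsIntegral.map_of_comp_eq (Subring.inclusion hle) (RingHom.id K) (by ext; rfl) ha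

/-- There are only finitely many elements of `A` of bounded absolute value. -/
lemma finite_coeffRing_le (hfd : ∀ t : K, Transcendental F t → FiniteDimensional F⟮t⟯ K)
    (hF : ∀ x : K, IsAlgebraic F x → x ∈ Set.range (algebraMap F K)) (P : Place K) (n : ℕ) :
    {a | a ∈ P.coeffRing ∧ P.v a ≤ WithZero.exp (n : ℤ)}.Finite := by
  induction n with
  | zero =>
    -- An element of `A` that is also integral at `P` has no pole at all, hence is a constant.
    refine (Set.finite_range (algebraMap F K)).subset fun a ha => hF a ?_
    by_contra h
    obtain ⟨w, hw⟩ := exists_place_one_lt hfd h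
    by_cases hwP : w = P
    · rw [hwP] at hw
      exact hw.not_ge ha.2
    · exact hw.not_ge (ha.1 w hwP)
  | succ n ih =>
    obtain ⟨t, hPt⟩ := P.surjective (WithZero.exp (-1))
    have ht0 : t ≠ 0 := by
      rintro rfl; rw [map_zero] at hPt; exact WithZero.exp_ne_zero hPt.symm
    have hPt1 : P.v t < 1 := by
      rw [hPt, ← WithZero.exp_zero, WithZero.exp_lt_exp]; omega
    have ht := P.transcendental_of_lt_one (F := F) ht0 hPt1
    have := hfd t ht
    have hpow : ∀ m : ℕ, P.v (t ^ m) = WithZero.exp (-(m : ℤ)) := fun m => by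
      rw [map_pow, hPt, ← WithZero.exp_nsmul]; simp
    let R : Submodule F K := P.ball F 1
    have hfin := finite_map_mkQ ht (R := R) (fun x hx => by
      change P.v _ ≤ 1
      rw [map_mul]; exact mul_le_one' hPt1.le hx)
    have hfin' := Module.finite_of_finite F (M := R.map (R.map (LinearMap.mulLeft F t)).mkQ)
    -- Read off the leading coefficient at `P`: `t ^ (n + 1) * a` modulo `t` lies in a finite space,
    -- and two elements with the same image differ by an element of the previous level.
    refine Set.Finite.of_finite_fibers
      (fun a => (R.map (LinearMap.mulLeft F t)).mkQ (t ^ (n + 1) * a)) ?_ ?_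
    · refine (Set.toFinite (R.map (R.map (LinearMap.mulLeft F t)).mkQ : Set _)).subset ?_
      rintro _ ⟨a, ha, rfl⟩
      refine ⟨_, ?_, rfl⟩
      change P.v _ ≤ 1
      rw [map_mul, hpow]
      refine (mul_le_mul_right ha.2 _).trans ?_
      rw [← WithZero.exp_add]; simp
    · rintro _ ⟨a, ha, rfl⟩
      refine (ih.image (fun x => x + a)).subset ?_
      rintro b ⟨hb, hab⟩
      refine ⟨b - a, ⟨sub_mem hb.1 ha.1, ?_⟩, sub_add_cancel b a⟩
      obtain ⟨y, hy, hyab⟩ := (Submodule.Quotient.eq _).mp hab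
      have hy' : t * (t ^ n * (b - a)) = t * y := by
        rw [LinearMap.mulLeft_apply] at hyab
        rw [hyab]; ring
      have h1 : P.v (t ^ n * (b - a)) ≤ 1 := by
        rw [mul_left_cancel₀ ht0 hy']; exact hy
      rwa [map_mul, hpow, WithZero.exp_neg, inv_mul_le_iff₀ (zero_lt_iff.mpr WithZero.exp_ne_zero),
        mul_one] at h1

lemma finite_coeffRing_absVal_le
    (hfd : ∀ t : K, Transcendental F t → FiniteDimensional F⟮t⟯ K)
    (hF : ∀ x : K, IsAlgebraic F x → x ∈ Set.range (algebraMap F K)) (P : Place K) (B : ℝ) :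
    {a | a ∈ P.coeffRing ∧ P.absVal a ≤ B}.Finite := by
  obtain ⟨x, hx⟩ := P.surjective (WithZero.exp 1)
  have h1 : 1 < P.absVal x := by
    rw [P.one_lt_absVal_iff, hx, ← WithZero.exp_zero, WithZero.exp_lt_exp]; exact one_pos
  obtain ⟨n, hn⟩ := pow_unbounded_of_one_lt B h1
  refine (finite_coeffRing_le hfd hF P n).subset fun a ha => ⟨ha.1, ?_⟩
  have : P.absVal a ≤ P.absVal (x ^ n) := by rw [map_pow]; exact ha.2.trans hn.le
  rw [P.absVal_le_iff, map_pow, hx, ← WithZero.exp_nsmul] at this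
  simpa using this

/-- The nontrivial quotients of `A` are finite. -/
lemma finite_quotient_coeffRing
    (hfd : ∀ t : K, Transcendental F t → FiniteDimensional F⟮t⟯ K) (P : Place K)
    {a : P.coeffRing} (ha : a ≠ 0) : Finite (P.coeffRing ⧸ Ideal.span {a}) := by
  have ha0 : (a : K) ≠ 0 := fun h => ha (Subtype.ext h)
  by_cases halg : IsAlgebraic F (a : K)
  · have hu : IsUnit a := IsUnit.of_mul_eq_one
      (⟨(a : K)⁻¹, fun w _ => w.v_le_one_of_isAlgebraic halg.inv⟩ : P.coeffRing)
      (Subtype.ext (mul_inv_cancel₀ ha0))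
    rw [Ideal.span_singleton_eq_top.mpr hu]
    exact Finite.of_subsingleton
  · have := hfd _ halg
    let R := coeffSubmodule F P
    have hfin := finite_map_mkQ (t := (a : K)) halg (R := R)
      (fun x hx => P.coeffRing.mul_mem a.2 hx)
    have hfin' := Module.finite_of_finite F
      (M := R.map (R.map (LinearMap.mulLeft F (a : K))).mkQ)
    refine Finite.of_injective
      (fun x : P.coeffRing ⧸ Ideal.span {a} =>
        (⟨(R.map (LinearMap.mulLeft F (a : K))).mkQ x.out, x.out, x.out.2, rfl⟩ :
          R.map (R.map (LinearMap.mulLeft F (a : K))).mkQ)) fun x y hxy => ?_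
    obtain ⟨z, hz, h⟩ := (Submodule.Quotient.eq _).mp (congrArg Subtype.val hxy)
    rw [← Quotient.out_eq x, ← Quotient.out_eq y]
    refine (Ideal.Quotient.mk_eq_mk_iff_sub_mem _ _).mpr (Ideal.mem_span_singleton.mpr
      ⟨⟨z, hz⟩, Subtype.ext ?_⟩)
    exact h.symm

lemma finite_of_isTorsionBy {R M : Type*} [CommRing R] [AddCommGroup M] [Module R M]
    [Module.Finite R M] {a : R} (ha : ∀ m : M, a • m = 0) [Finite (R ⧸ Ideal.span {a})] :
    Finite M := by
  have h : Module.IsTorsionBySet R M (Ideal.span {a}) :=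
    (Module.isTorsionBySet_span_singleton_iff a).mpr fun {m} => ha m
  let := h.module
  have : IsScalarTower R (R ⧸ Ideal.span {a}) M := h.isScalarTower
  have := Module.Finite.of_restrictScalars_finite R (R ⧸ Ideal.span {a}) M
  exact Module.finite_of_finite (R ⧸ Ideal.span {a})

/-! ### Lattices -/

variable {P : Place K} {r : ℕ}

lemma exists_smul_le_of_fg {P : Place K} {V : Type*} [AddCommGroup V] [Module P.coeffRing V]
    {Y Y' : Submodule P.coeffRing V} (hY' : Y'.FG)
    (h : ∀ y ∈ Y', ∃ a : P.coeffRing, a ≠ 0 ∧ a • y ∈ Y) :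
    ∃ a : P.coeffRing, a ≠ 0 ∧ ∀ y ∈ Y', a • y ∈ Y := by
  classical
  obtain ⟨s, rfl⟩ := hY'
  choose! a ha0 ha using h
  refine ⟨∏ y ∈ s, a y, Finset.prod_ne_zero_iff.mpr fun y hy => ha0 y (Submodule.subset_span hy),
    fun y hy => ?_⟩
  have : Submodule.span P.coeffRing (s : Set V) ≤
      Y.comap (LinearMap.lsmul P.coeffRing V (∏ y ∈ s, a y)) := by
    refine Submodule.span_le.mpr fun z hz => ?_
    change (∏ y ∈ s, a y) • z ∈ Y
    rw [← Finset.prod_erase_mul _ _ (Finset.mem_coe.mp hz), mul_smul]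
    exact Y.smul_mem _ (ha z (Submodule.subset_span hz))
  exact this hy

lemma Lattice.exists_smul_mem
    (hfd : ∀ t : K, Transcendental F t → FiniteDimensional F⟮t⟯ K)
    (hF : ∀ x : K, IsAlgebraic F x → x ∈ Set.range (algebraMap F K)) (Y : Lattice P r)
    (y : Fin r → K) : ∃ a : P.coeffRing, a ≠ 0 ∧ a • y ∈ Y.1 := by
  have hy : y ∈ Submodule.span K (Y.1 : Set (Fin r → K)) := by
    rw [Y.2.span_eq_top]; trivial
  induction hy using Submodule.span_induction with
  | mem y hy => exact ⟨1, one_ne_zero, by rwa [one_smul]⟩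
  | zero => exact ⟨1, one_ne_zero, by rw [smul_zero]; exact Y.1.zero_mem⟩
  | add y z _ _ hy hz =>
    obtain ⟨a, ha, hay⟩ := hy
    obtain ⟨b, hb, hbz⟩ := hz
    refine ⟨a * b, mul_ne_zero ha hb, ?_⟩
    rw [smul_add]
    refine add_mem ?_ ?_
    · rw [mul_comm, mul_smul]; exact Y.1.smul_mem _ hay
    · rw [mul_smul]; exact Y.1.smul_mem _ hbz
  | smul k y _ hy =>
    obtain ⟨a, ha, hay⟩ := hy
    obtain ⟨b, hbA, hb, hbk⟩ := exists_mul_mem_coeffRing hfd hF P k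
    refine ⟨a * ⟨b, hbA⟩, mul_ne_zero ha (fun h => hb (congrArg Subtype.val h)), ?_⟩
    have : (a * ⟨b, hbA⟩ : P.coeffRing) • k • y = (⟨b * k, hbk⟩ : P.coeffRing) • a • y := by
      ext i
      simp only [Pi.smul_apply, Subring.smul_def, smul_eq_mul, Subring.coe_mul]
      ring
    rw [this]
    exact Y.1.smul_mem _ hay

/-- The index of a lattice in a larger one is finite. -/
lemma Lattice.finite_quotient
    (hfd : ∀ t : K, Transcendental F t → FiniteDimensional F⟮t⟯ K)
    (hF : ∀ x : K, IsAlgebraic F x → x ∈ Set.range (algebraMap F K)) (Y Y' : Lattice P r) :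
    Finite (Y'.1 ⧸ Y.1.submoduleOf Y'.1) := by
  obtain ⟨a, ha, h⟩ := exists_smul_le_of_fg Y'.2.fg
    (fun y _ => Lattice.exists_smul_mem hfd hF Y y)
  have := finite_quotient_coeffRing hfd P ha
  have : Module.Finite P.coeffRing Y'.1 := Module.Finite.iff_fg.mpr Y'.2.fg
  -- Since `a Y' ⊆ Y`, the quotient is a finitely generated module over the finite ring `A/aA`.
  refine finite_of_isTorsionBy (a := a) fun m => ?_
  induction m using Submodule.Quotient.induction_on with
  | _ y =>
    rw [← Submodule.Quotient.mk_smul, Submodule.Quotient.mk_eq_zero]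
    exact h y y.2

/-- A lattice is discrete in `V`. -/
lemma Lattice.finite_absVal_le
    (hfd : ∀ t : K, Transcendental F t → FiniteDimensional F⟮t⟯ K)
    (hF : ∀ x : K, IsAlgebraic F x → x ∈ Set.range (algebraMap F K)) (Y : Lattice P r) (B : ℝ) :
    {y | y ∈ Y.1 ∧ ∀ i, P.absVal (y i) ≤ B}.Finite := by
  -- Comparison with the standard lattice `A ^ r`: a common denominator `a` moves `Y` into it, and
  -- bounded elements of `A` are finite in number.
  let Y₀ : Submodule P.coeffRing (Fin r → K) :=
    Submodule.pi Set.univ fun _ => Submodule.span P.coeffRing {(1 : K)}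
  have hY₀ : ∀ y, y ∈ Y₀ → ∀ i, y i ∈ P.coeffRing := fun y hy i => by
    obtain ⟨c, hc⟩ := Submodule.mem_span_singleton.mp (hy i trivial)
    rw [← hc, Subring.smul_def, smul_eq_mul, mul_one]; exact c.2
  have hY₀' : ∀ y : Fin r → K, (∀ i, y i ∈ P.coeffRing) → y ∈ Y₀ := fun y hy i _ =>
    Submodule.mem_span_singleton.mpr ⟨⟨y i, hy i⟩, by
      rw [Subring.smul_def, smul_eq_mul, mul_one]⟩
  obtain ⟨a, ha, h⟩ := exists_smul_le_of_fg (Y := Y₀) Y.2.fg (fun y _ => by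
    choose b hbA hb hby using fun i => exists_mul_mem_coeffRing hfd hF P (y i)
    refine ⟨∏ i, ⟨b i, hbA i⟩, Finset.prod_ne_zero_iff.mpr
      fun i _ h => hb i (congrArg Subtype.val h), hY₀' _ fun i => ?_⟩
    classical
    rw [← Finset.prod_erase_mul _ _ (Finset.mem_univ i), mul_smul, Pi.smul_apply,
      Subring.smul_def, smul_eq_mul]
    exact mul_mem (Subtype.property _) (hby i))
  have ha0 : (a : K) ≠ 0 := fun h => ha (Subtype.ext h)
  have hfin := Set.Finite.pi' (ι := Fin r)
    fun _ => finite_coeffRing_absVal_le hfd hF P (P.absVal a * B)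
  refine (hfin.preimage (f := fun y : Fin r → K => (a : K) • y)
    (smul_right_injective _ ha0).injOn).subset fun y hy i => ?_
  refine ⟨hY₀ _ (h y hy.1) i, ?_⟩
  change P.absVal (a * y i) ≤ _
  rw [map_mul]
  exact mul_le_mul_of_nonneg_left (hy.2 i) (P.absVal.nonneg _)

end CoeffRingFiniteness

/-! ### Infinite products in ultrametric fields -/

section Products

open Filter Topology

variable {C : Type*} [NormedField C] [IsUltrametricDist C] {ι : Type*}

lemma norm_prod_one_add_sub_one_le (s : Finset ι) (a : ι → C) {δ : ℝ} (hδ0 : 0 ≤ δ) (hδ : δ ≤ 1)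
    (ha : ∀ i ∈ s, ‖a i‖ ≤ δ) : ‖∏ i ∈ s, (1 + a i) - 1‖ ≤ δ := by
  classical
  induction s using Finset.induction_on with
  | empty => simpa
  | insert i s his ih =>
    have ih := ih fun j hj => ha j (Finset.mem_insert_of_mem hj)
    have h1 : ‖∏ i ∈ s, (1 + a i)‖ ≤ 1 := by
      rw [← sub_add_cancel (∏ i ∈ s, (1 + a i)) 1]
      refine (IsUltrametricDist.norm_add_le_max _ _).trans (max_le (ih.trans hδ) ?_)
      rw [norm_one]
    rw [Finset.prod_insert his,
      show (1 + a i) * ∏ i ∈ s, (1 + a i) - 1 = (∏ i ∈ s, (1 + a i) - 1) +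
        a i * ∏ i ∈ s, (1 + a i) by ring]
    refine (IsUltrametricDist.norm_add_le_max _ _).trans (max_le ih ?_)
    rw [norm_mul]
    calc _ ≤ δ * 1 := mul_le_mul (ha i (Finset.mem_insert_self _ _)) h1 (norm_nonneg _) hδ0
      _ = δ := mul_one δ

/-- The partial products of `∏ (1 + h i)` converge uniformly if `h` is dominated by a family of
constants that tends to zero. -/
lemma exists_finset_norm_prod_sub_prod_le {X : Type*} {h : ι → X → C} {c : ι → ℝ}
    (hc : Tendsto c cofinite (𝓝 0)) (hhc : ∀ i x, ‖h i x‖ ≤ c i) {ε : ℝ} (hε : 0 < ε) :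
    ∃ s : Finset ι, ∀ t, s ⊆ t → ∀ x,
      ‖∏ i ∈ t, (1 + h i x) - ∏ i ∈ s, (1 + h i x)‖ ≤ ε := by
  classical
  have hfin : ∀ δ : ℝ, 0 < δ → {i | ¬ c i < δ}.Finite := fun δ hδ =>
    (hc.eventually (gt_mem_nhds hδ))
  -- Outside `s₀` the perturbations have norm below `1`, so products of those factors have norm at
  -- most `1`. Hence `B` bounds every partial product that contains `s₀`, and it remains to bring
  -- the tail within `ε / B` of `1`.
  set s₀ := (hfin 1 one_pos).toFinset with hs₀
  set B := ∏ i ∈ s₀, (1 + |c i|) with hB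
  have hB0 : 0 < B := Finset.prod_pos fun i _ => by positivity
  have hbound : ∀ t, s₀ ⊆ t → ∀ x, ‖∏ i ∈ t, (1 + h i x)‖ ≤ B := by
    intro t ht x
    rw [← Finset.prod_sdiff ht, norm_mul]
    have h1 : ‖∏ i ∈ t \ s₀, (1 + h i x)‖ ≤ 1 := by
      rw [← sub_add_cancel (∏ i ∈ t \ s₀, (1 + h i x)) 1]
      refine (IsUltrametricDist.norm_add_le_max _ _).trans (max_le ?_ norm_one.le)
      refine norm_prod_one_add_sub_one_le _ _ zero_le_one le_rfl fun i hi => ?_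
      have : c i < 1 := by
        by_contra hci
        exact (Finset.mem_sdiff.mp hi).2 ((hfin 1 one_pos).mem_toFinset.mpr hci)
      exact (hhc i x).trans this.le
    have h2 : ‖∏ i ∈ s₀, (1 + h i x)‖ ≤ B := by
      rw [norm_prod]
      refine Finset.prod_le_prod (fun _ _ => norm_nonneg _) fun i _ => ?_
      refine (norm_add_le _ _).trans (add_le_add norm_one.le ((hhc i x).trans (le_abs_self _)))
    calc _ ≤ 1 * B := mul_le_mul h1 h2 (norm_nonneg _) zero_le_one
      _ = B := one_mul B
  set δ := min 1 (ε / B) with hδ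
  have hδ0 : 0 < δ := lt_min one_pos (div_pos hε hB0)
  refine ⟨(hfin δ hδ0).toFinset ∪ s₀, fun t ht x => ?_⟩
  set s := (hfin δ hδ0).toFinset ∪ s₀ with hs
  rw [← Finset.prod_sdiff ht, ← sub_one_mul, norm_mul]
  have h1 : ‖∏ i ∈ t \ s, (1 + h i x) - 1‖ ≤ δ := by
    refine norm_prod_one_add_sub_one_le _ _ hδ0.le (min_le_left _ _) fun i hi => ?_
    have : c i < δ := by
      by_contra hci
      exact (Finset.mem_sdiff.mp hi).2
        (Finset.mem_union_left _ ((hfin δ hδ0).mem_toFinset.mpr hci))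
    exact (hhc i x).trans this.le
  calc _ ≤ (ε / B) * B := mul_le_mul (h1.trans (min_le_right _ _))
        (hbound s Finset.subset_union_right x) (norm_nonneg _) (by positivity)
    _ = ε := div_mul_cancel₀ _ hB0.ne'

variable [CompleteSpace C]

lemma multipliable_one_add_of_tendsto {a : ι → C} (ha : Tendsto a cofinite (𝓝 0)) :
    Multipliable fun i => 1 + a i := by
  classical
  have hcau : CauchySeq fun s : Finset ι => ∏ i ∈ s, (1 + a i) := by
    refine Metric.cauchySeq_iff'.mpr fun ε hε => ?_
    obtain ⟨s, hs⟩ := exists_finset_norm_prod_sub_prod_le (X := Unit) (h := fun i _ => a i)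
      (c := fun i => ‖a i‖) (by simpa using ha.norm) (fun _ _ => le_rfl) (half_pos hε)
    refine ⟨s, fun t ht => ?_⟩
    rw [dist_eq_norm]
    exact (hs t ht ()).trans_lt (half_lt_self hε)
  obtain ⟨x, hx⟩ := cauchySeq_tendsto_of_complete hcau
  refine ⟨x, ?_⟩
  simpa [HasProd] using hx

/-- The inverses `1 / (1 + a i) = 1 + (-a i / (1 + a i))` again form a convergent product, and the
two products multiply to `1`. -/
lemma tprod_one_add_ne_zero {a : ι → C} (ha : Tendsto a cofinite (𝓝 0))
    (h0 : ∀ i, 1 + a i ≠ 0) : ∏' i, (1 + a i) ≠ 0 := by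
  have hb : Tendsto (fun i => -a i / (1 + a i)) cofinite (𝓝 0) := by
    have h1 : Tendsto (fun i => 1 + a i) cofinite (𝓝 1) := by
      simpa using (tendsto_const_nhds (x := (1 : C))).add ha
    have h2 := ha.neg.div h1 one_ne_zero
    rw [neg_zero, zero_div] at h2
    exact h2
  have h := (multipliable_one_add_of_tendsto ha).tprod_mul (multipliable_one_add_of_tendsto hb)
  have h1 : ∀ i, (1 + a i) * (1 + -a i / (1 + a i)) = 1 := fun i => by
    have := h0 i; field_simp; ring
  simp_rw [h1, tprod_one] at h
  exact left_ne_zero_of_mul (h ▸ one_ne_zero)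

lemma norm_tprod_sub_prod_le {X : Type*} {h : ι → X → C} {c : ι → ℝ}
    (hc : Tendsto c cofinite (𝓝 0)) (hhc : ∀ i x, ‖h i x‖ ≤ c i) {ε : ℝ} (hε : 0 < ε) :
    ∃ s : Finset ι, ∀ x, ‖∏' i, (1 + h i x) - ∏ i ∈ s, (1 + h i x)‖ ≤ ε := by
  obtain ⟨s, hs⟩ := exists_finset_norm_prod_sub_prod_le hc hhc hε
  refine ⟨s, fun x => ?_⟩
  have hm : Multipliable fun i => 1 + h i x := multipliable_one_add_of_tendsto
    (squeeze_zero_norm (fun i => hhc i x) hc)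
  have ht : Tendsto (fun t : Finset ι => ∏ i ∈ t, (1 + h i x)) atTop (𝓝 (∏' i, (1 + h i x))) := by
    simpa [HasProd] using hm.hasProd
  refine le_of_tendsto (ht.sub_const _).norm ?_
  filter_upwards [eventually_ge_atTop s] with t ht using hs t ht x

end Products

/-! ### Exponential functions of discrete subspaces of an ultrametric field -/

section Exponential

open Filter Topology

variable {C : Type*} [NormedField C]

/-- A subset of `C` is strongly discrete if it meets each ball in a finite set. -/
def IsStronglyDiscrete (Λ : Set C) : Prop := ∀ B : ℝ, {l | l ∈ Λ ∧ ‖l‖ ≤ B}.Finite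

/-- The exponential function `z ∏' (1 - z / λ)` of a subset `Λ` of `C`. -/
def expFn (Λ : Set C) (z : C) : C := z * ∏' l : {l : C // l ∈ Λ ∧ l ≠ 0}, (1 - z / l)

open Classical in
/-- The factor of the exponential function that vanishes at `z = l`. -/
def expFactor (z l : C) : C := if l = 0 then z else 1 - z / l

lemma expFactor_zero (z : C) : expFactor z 0 = z := if_pos rfl

lemma expFactor_of_ne_zero (z : C) {l : C} (hl : l ≠ 0) : expFactor z l = 1 - z / l := if_neg hl

lemma expFactor_eq_zero_iff {z l : C} : expFactor z l = 0 ↔ z = l := by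
  by_cases hl : l = 0
  · rw [hl, expFactor_zero]
  · rw [expFactor_of_ne_zero z hl, sub_eq_zero, eq_div_iff hl, one_mul, eq_comm]

/-- The factorwise form of expanding the exponential function around a point `u` outside its zero
set. -/
lemma expFactor_sub (u z w : C) (h : u - w ≠ 0) :
    expFactor (u - z) w = expFactor u w * (1 - z / (u - w)) := by
  by_cases hw : w = 0
  · rw [hw, expFactor_zero, expFactor_zero]
    rw [hw, sub_zero] at h
    rw [sub_zero]; field_simp
  · rw [expFactor_of_ne_zero _ hw, expFactor_of_ne_zero _ hw]
    field_simp; ring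

lemma IsStronglyDiscrete.mono {Λ Λ' : Set C} (h : IsStronglyDiscrete Λ') (hle : Λ ⊆ Λ') :
    IsStronglyDiscrete Λ := fun B => (h B).subset fun _ hx => ⟨hle hx.1, hx.2⟩

lemma isStronglyDiscrete_of_finite {Λ : Set C} (h : Λ.Finite) : IsStronglyDiscrete Λ :=
  fun _ => h.subset fun _ hx => hx.1

lemma IsStronglyDiscrete.tendsto_div_add {Λ : Set C} (h : IsStronglyDiscrete Λ) (z u : C) :
    Tendsto (fun l : Λ => z / (u + l)) cofinite (𝓝 0) := by
  rw [Metric.tendsto_nhds]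
  intro ε hε
  have hfin := (h (‖z‖ / ε + ‖u‖)).preimage (f := fun l : Λ => (l : C)) Subtype.val_injective.injOn
  refine hfin.subset fun l hl => ?_
  have hl' : ε ≤ ‖z / (u + l)‖ := by simpa [dist_zero_right] using hl
  refine ⟨l.2, ?_⟩
  -- At `l = -u` the quotient is `0` by the convention for division by zero, so this index does not
  -- occur among the large terms.
  have h0 : u + (l : C) ≠ 0 := fun h0 => by
    rw [h0, div_zero, norm_zero] at hl'; exact hl'.not_gt hε
  rw [norm_div, le_div_iff₀ (norm_pos_iff.mpr h0)] at hl'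
  have h1 : ‖u + (l : C)‖ ≤ ‖z‖ / ε := by rw [le_div_iff₀ hε, mul_comm]; exact hl'
  calc ‖(l : C)‖ = ‖(u + l) - u‖ := by rw [add_sub_cancel_left]
    _ ≤ ‖u + (l : C)‖ + ‖u‖ := norm_sub_le _ _
    _ ≤ _ := by gcongr

lemma IsStronglyDiscrete.expFactor_sub_one_tendsto {Λ : Set C} (h : IsStronglyDiscrete Λ) (z : C) :
    Tendsto (fun l : Λ => expFactor z l - 1) cofinite (𝓝 0) := by
  have h1 : Tendsto (fun l : Λ => -(z / (0 + l))) cofinite (𝓝 0) := by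
    simpa using (h.tendsto_div_add z 0).neg
  refine h1.congr' ?_
  have h2 : {l : Λ | (l : C) = 0}.Finite :=
    Set.Subsingleton.finite fun a ha b hb => Subtype.ext (ha.trans hb.symm)
  filter_upwards [h2.compl_mem_cofinite] with l hl
  rw [expFactor_of_ne_zero z hl, zero_add]; ring

variable [IsUltrametricDist C] [CompleteSpace C]

lemma IsStronglyDiscrete.multipliable_one_sub {Λ : Set C} (h : IsStronglyDiscrete Λ) (z u : C) :
    Multipliable fun l : Λ => 1 - z / (u + l) := by
  simp_rw [sub_eq_add_neg]
  exact multipliable_one_add_of_tendsto (by simpa using (h.tendsto_div_add z u).neg)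

lemma IsStronglyDiscrete.multipliable_expFactor {Λ : Set C} (h : IsStronglyDiscrete Λ) (z : C) :
    Multipliable fun l : Λ => expFactor z l := by
  simpa using multipliable_one_add_of_tendsto (h.expFactor_sub_one_tendsto z)

/-- Absorbing the leading `z` as the factor at `0` turns the product into one over the whole group,
which can be reindexed by translations and split into cosets. -/
lemma expFn_eq_tprod {Λ : Set C} (h : IsStronglyDiscrete Λ) (h0 : (0 : C) ∈ Λ) (z : C) :
    expFn Λ z = ∏' l : Λ, expFactor z l := by
  classical
  have hm : Multipliable (Function.update (fun l : Λ => expFactor z l) ⟨0, h0⟩ 1) := by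
    have h2 := multipliable_one_add_of_tendsto
      (a := fun l : Λ => Function.update (fun l : Λ => expFactor z l) ⟨0, h0⟩ 1 l - 1) (by
      refine (h.expFactor_sub_one_tendsto z).congr' ?_
      filter_upwards [(Set.finite_singleton (⟨0, h0⟩ : Λ)).compl_mem_cofinite] with l hl
      rw [Function.update_of_ne hl])
    simpa using h2
  rw [hm.tprod_eq_mul_tprod_ite', expFactor_zero, expFn]
  congr 1
  let g : {l : C // l ∈ Λ ∧ l ≠ 0} → Λ := fun l => ⟨l, l.2.1⟩
  have hg : Function.Injective g := fun a b hab => Subtype.ext (congrArg (fun x : Λ => (x : C)) hab)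
  rw [← hg.tprod_eq]
  · refine tprod_congr fun l => ?_
    rw [if_neg (fun h => l.2.2 (congrArg (fun x : Λ => (x : C)) h)), expFactor_of_ne_zero z l.2.2]
  · intro l hl
    by_cases hl0 : l = ⟨0, h0⟩
    · simp [hl0] at hl
    · exact ⟨⟨l, l.2, fun h => hl0 (Subtype.ext h)⟩, rfl⟩

lemma expFn_eq_zero_iff {Λ : Set C} (h : IsStronglyDiscrete Λ) (h0 : (0 : C) ∈ Λ) {z : C} :
    expFn Λ z = 0 ↔ z ∈ Λ := by
  rw [expFn_eq_tprod h h0]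
  constructor
  · intro hz
    by_contra hzΛ
    refine tprod_one_add_ne_zero (h.expFactor_sub_one_tendsto z) (fun l => ?_)
      (by simpa using hz)
    rw [add_sub_cancel, Ne, expFactor_eq_zero_iff]
    rintro rfl
    exact hzΛ l.2
  · intro hz
    refine (hasProd_zero_of_exists_eq_zero ⟨⟨z, hz⟩, expFactor_eq_zero_iff.mpr rfl⟩).tprod_eq

variable {F : Type*} [Field F] [Algebra F C]

lemma expFn_eq_prod (W : Submodule F C) [Fintype W] (z : C) :
    expFn (W : Set C) z = ∏ l : W, expFactor z l := by
  rw [expFn_eq_tprod (isStronglyDiscrete_of_finite (Set.toFinite _)) W.zero_mem]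
  exact tprod_fintype _

/-- The product on the right runs over the coset `u + Λ`; thus the contribution of a nontrivial
coset to a larger exponential function is `e(u - z) / e(u)`. The sign of `w` is absorbed by the
symmetry of `Λ`. -/
lemma expFn_sub {Λ : Submodule F C} (h : IsStronglyDiscrete (Λ : Set C)) {u : C} (hu : u ∉ Λ)
    (z : C) : expFn (Λ : Set C) (u - z)
      = expFn (Λ : Set C) u * ∏' w : (Λ : Set C), (1 - z / (u + w)) := by
  let e : (Λ : Set C) ≃ (Λ : Set C) := Equiv.neg Λ
  have he : ∀ w, (e w : C) = -w := fun w => rfl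
  have hm : Multipliable fun w : (Λ : Set C) => 1 - z / (u - w) := by
    refine (e.multipliable_iff (f := fun w : (Λ : Set C) => 1 - z / (u - w))).mp ?_
    refine (h.multipliable_one_sub z u).congr fun w => ?_
    simp [he]
  rw [expFn_eq_tprod h Λ.zero_mem, expFn_eq_tprod h Λ.zero_mem,
    ← e.tprod_eq (fun w : (Λ : Set C) => (1 - z / (u + w)))]
  simp_rw [he, ← sub_eq_add_neg]
  rw [← (h.multipliable_expFactor u).tprod_mul hm]
  refine tprod_congr fun w => expFactor_sub u z w fun h0 => hu ?_
  rw [sub_eq_zero.mp h0]; exact w.2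

/-- The exponential function of a discrete space `Λ'` is the composition of the exponential
function of a subspace `Λ` of finite index, if that one is linear, with the exponential function
of the image of `Λ'`. -/
lemma expFn_comp {Λ Λ' : Submodule F C} (h : IsStronglyDiscrete (Λ' : Set C)) (hle : Λ ≤ Λ')
    [Finite (Λ' ⧸ Λ.submoduleOf Λ')] (e : C →ₗ[F] C) (he : ∀ z, e z = expFn (Λ : Set C) z)
    (z : C) : expFn (Λ' : Set C) z = expFn (Λ'.map e : Set C) (e z) := by
  classical
  have hΛ : IsStronglyDiscrete (Λ : Set C) := h.mono hle
  have := Fintype.ofFinite (Λ' ⧸ Λ.submoduleOf Λ')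
  let Q := Λ' ⧸ Λ.submoduleOf Λ'
  have hker : ∀ x, e x = 0 ↔ x ∈ Λ := fun x => by
    rw [he]; exact expFn_eq_zero_iff hΛ Λ.zero_mem
  have hmk : ∀ a b : Λ', (Submodule.Quotient.mk a : Q) = Submodule.Quotient.mk b ↔
      (a : C) - b ∈ Λ := fun a b => (Submodule.Quotient.eq _).trans Iff.rfl
  have hout : ∀ x : Q, (Submodule.Quotient.mk (Quotient.out x) : Q) = x := fun x =>
    Quotient.out_eq x
  have hout0 : ∀ x : Q, x = 0 ↔ ((Quotient.out x : Λ') : C) ∈ Λ := fun x => by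
    conv_lhs => rw [← hout x, ← Submodule.Quotient.mk_zero, hmk]
    simp
  let E : Q × Λ → Λ' := fun p => Quotient.out p.1 + ⟨p.2, hle p.2.2⟩
  have hE : Function.Bijective E := by
    constructor
    · rintro ⟨x, w⟩ ⟨y, w'⟩ hxy
      have h1 : ((Quotient.out x : Λ') : C) + w = (Quotient.out y : Λ') + w' :=
        congrArg Subtype.val hxy
      have hxy' : x = y := by
        rw [← hout x, ← hout y, hmk]
        have : ((Quotient.out x : Λ') : C) - (Quotient.out y : Λ') = w' - w := by
          linear_combination h1
        rw [this]
        exact sub_mem w'.2 w.2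
      subst hxy'
      exact Prod.ext rfl (Subtype.ext (add_left_cancel h1))
    · intro l
      let x : Q := Submodule.Quotient.mk l
      have h1 : (l : C) - (Quotient.out x : Λ') ∈ Λ := (hmk _ _).mp (hout x).symm
      exact ⟨(x, ⟨_, h1⟩), Subtype.ext (add_sub_cancel _ _)⟩
  let E' : Q × (Λ : Set C) ≃ (Λ' : Set C) := Equiv.ofBijective E hE
  have hE' : ∀ p : Q × (Λ : Set C), (E' p : C) = (Quotient.out p.1 : Λ') + p.2 := fun _ => rfl
  -- A whole coset collapses to one factor. For a nontrivial coset, linearity gives `e(x - z) / e(x)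
  -- = 1 - e(z) / e(x)`; the trivial coset gives `e(z)`.
  have hfib : ∀ x : Q, ∏' w : (Λ : Set C), expFactor z ((Quotient.out x : Λ') + w) =
      expFactor (e z) (e (Quotient.out x : Λ')) := by
    intro x
    by_cases hx : ((Quotient.out x : Λ') : C) ∈ Λ
    · rw [(hker _).mpr hx, expFactor_zero, he, expFn_eq_tprod hΛ Λ.zero_mem]
      let s : (Λ : Set C) ≃ (Λ : Set C) := Equiv.addLeft (⟨_, hx⟩ : Λ)
      exact s.tprod_eq (fun w : (Λ : Set C) => expFactor z w)
    · have h0 : e (Quotient.out x : Λ') ≠ 0 := fun h0 => hx ((hker _).mp h0)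
      have h1 := expFn_sub hΛ hx z
      rw [← he, ← he, map_sub] at h1
      rw [expFactor_of_ne_zero _ h0, ← div_self h0, ← sub_div, h1, mul_div_cancel_left₀ _ h0]
      refine tprod_congr fun w => expFactor_of_ne_zero _ fun h2 => hx ?_
      rw [eq_neg_of_add_eq_zero_left h2]
      exact neg_mem w.2
  have hm : ∀ x : Q, Multipliable fun w : (Λ : Set C) =>
      expFactor z ((Quotient.out x : Λ') + w) := fun x => by
    have hinj : Function.Injective fun w : (Λ : Set C) => E' (x, w) := fun a b hab =>
      (Prod.ext_iff.mp (E'.injective hab)).2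
    have ht := (h.expFactor_sub_one_tendsto z).comp hinj.tendsto_cofinite
    refine (multipliable_one_add_of_tendsto ht).congr fun w => ?_
    simp [hE']
  have hm' : Multipliable fun p : Q × (Λ : Set C) =>
      expFactor z ((Quotient.out p.1 : Λ') + p.2) :=
    (E'.multipliable_iff (f := fun l : (Λ' : Set C) => expFactor z l)).mpr
      (h.multipliable_expFactor z)
  have hfinW : Finite (Λ'.map e) := by
    refine Finite.of_surjective (fun x : Q => (⟨e (Quotient.out x : Λ'), _, (Quotient.out x).2, rfl⟩ :
      Λ'.map e)) ?_
    rintro ⟨_, l, hl, rfl⟩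
    refine ⟨Submodule.Quotient.mk ⟨l, hl⟩, Subtype.ext ?_⟩
    refine sub_eq_zero.mp ?_
    rw [← map_sub, hker]
    exact (hmk _ ⟨l, hl⟩).mp (hout _)
  have := Fintype.ofFinite (Λ'.map e)
  rw [expFn_eq_prod (Λ'.map e), expFn_eq_tprod h Λ'.zero_mem,
    ← E'.tprod_eq (fun l : (Λ' : Set C) => expFactor z l)]
  simp_rw [hE']
  rw [hm'.tprod_prod' hm, tprod_fintype]
  simp_rw [hfib]
  refine Fintype.prod_bijective (fun x : Q => (⟨e (Quotient.out x : Λ'), _, (Quotient.out x).2, rfl⟩ :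
      Λ'.map e)) ⟨fun x y hxy => ?_, ?_⟩ _ _ fun x => rfl
  · have h1 : e (Quotient.out x : Λ') = e (Quotient.out y : Λ') := congrArg Subtype.val hxy
    rw [← hout x, ← hout y, hmk, ← hker, map_sub, h1, sub_self]
  · rintro ⟨_, l, hl, rfl⟩
    refine ⟨Submodule.Quotient.mk ⟨l, hl⟩, Subtype.ext ?_⟩
    refine sub_eq_zero.mp ?_
    rw [← map_sub, hker]
    exact (hmk _ ⟨l, hl⟩).mp (hout _)

end Exponential

/-! ### `q`-polynomials and linearity of the exponential functions -/

section QPolynomials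

open Polynomial

/-- The product of the linear factors of `X ^ q - X`. -/
lemma prod_sub_algebraMap {F C : Type*} [Field F] [Fintype F] [Field C] [Algebra F C] (t : C) :
    ∏ c : F, (t - algebraMap F C c) = t ^ Nat.card F - t := by
  have h : ∏ c : F, (X - Polynomial.C c) = (X ^ Fintype.card F - X : F[X]) := by
    have h1 : (X ^ Fintype.card F - X : F[X]).natDegree = Fintype.card F :=
      FiniteField.X_pow_card_sub_X_natDegree_eq F Fintype.one_lt_card
    have h2 : (X ^ Fintype.card F - X : F[X]).Monic :=
      monic_X_pow_sub (by rw [degree_X]; exact_mod_cast Fintype.one_lt_card)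
    have h3 := FiniteField.roots_X_pow_card_sub_X F
    have h4 := prod_multiset_X_sub_C_of_monic_of_roots_card_eq h2 (by rw [h3, h1]; rfl)
    rw [h3] at h4
    exact h4
  have h' := congrArg (aeval t) h
  simpa [map_prod, Nat.card_eq_fintype_card] using h'

variable (F : Type*) {C : Type*} [Field F] [Finite F] [Field C] [Algebra F C]

/-- Polynomials in which only the exponents `1, q, q ^ 2, …` occur, where `q = #F`. -/
def IsQPolynomial (f : C[X]) : Prop := ∀ n, f.coeff n ≠ 0 → ∃ i : ℕ, n = Nat.card F ^ i

lemma exists_expChar_card : ∃ p m : ℕ, 0 < m ∧ p.Prime ∧ ExpChar C p ∧ Nat.card F = p ^ m := by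
  have := Fintype.ofFinite F
  obtain ⟨p, hp⟩ := CharP.exists F
  obtain ⟨m, hprime, hm⟩ := FiniteField.card F p
  have : CharP C p := charP_of_injective_algebraMap (algebraMap F C).injective p
  exact ⟨p, m, m.pos, hprime, ExpChar.prime hprime, by rw [Nat.card_eq_fintype_card, hm]⟩

lemma add_pow_card_pow (x y : C) (i : ℕ) :
    (x + y) ^ Nat.card F ^ i = x ^ Nat.card F ^ i + y ^ Nat.card F ^ i := by
  obtain ⟨p, m, -, -, hp, h⟩ := exists_expChar_card F (C := C)
  rw [h, ← pow_mul, add_pow_expChar_pow]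

lemma smul_pow_card_pow (c : F) (x : C) (i : ℕ) :
    (c • x) ^ Nat.card F ^ i = c • x ^ Nat.card F ^ i := by
  have := Fintype.ofFinite F
  rw [_root_.smul_pow, Nat.card_eq_fintype_card, FiniteField.pow_card_pow]

lemma one_lt_card : 1 < Nat.card F := Finite.one_lt_card

variable {F}

/-- The `F`-linear map given by a `q`-polynomial. -/
def IsQPolynomial.toLinearMap {f : C[X]} (hf : IsQPolynomial F f) : C →ₗ[F] C where
  toFun z := f.eval z
  map_add' x y := by
    simp only [eval_eq_sum, Polynomial.sum, ← Finset.sum_add_distrib]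
    refine Finset.sum_congr rfl fun n hn => ?_
    obtain ⟨i, rfl⟩ := hf n (mem_support_iff.mp hn)
    rw [add_pow_card_pow, mul_add]
  map_smul' c x := by
    simp only [eval_eq_sum, Polynomial.sum, Finset.smul_sum, RingHom.id_apply]
    refine Finset.sum_congr rfl fun n hn => ?_
    obtain ⟨i, rfl⟩ := hf n (mem_support_iff.mp hn)
    rw [smul_pow_card_pow, mul_smul_comm]

lemma IsQPolynomial.toLinearMap_apply {f : C[X]} (hf : IsQPolynomial F f) (z : C) :
    hf.toLinearMap z = f.eval z := rfl

variable (F) in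
-- In characteristic `p`, raising to the power `q` applies Frobenius to the coefficients and
-- substitutes `X ^ q` for `X`.
lemma exists_of_coeff_pow_card_ne_zero {f : C[X]} {n : ℕ} (h : (f ^ Nat.card F).coeff n ≠ 0) :
    ∃ k, n = k * Nat.card F ∧ f.coeff k ≠ 0 := by
  obtain ⟨p, m, hm, hprime, hp, hq⟩ := exists_expChar_card F (C := C)
  rw [hq, ← map_iterateFrobenius_expand, coeff_map, coeff_expand (pow_pos hprime.pos m)] at h
  split_ifs at h with hdvd
  · obtain ⟨k, rfl⟩ := hdvd
    refine ⟨k, by rw [hq, mul_comm], fun h0 => h ?_⟩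
    rw [Nat.mul_div_cancel_left _ (pow_pos hprime.pos m), h0, map_zero]
  · exact absurd (map_zero _) h

/-- This is the composition of `X - a X ^ q`, the exponential function of a line, with `f`; it
occurs when one generator is adjoined to a finite space. -/
lemma IsQPolynomial.sub_C_mul_pow {f : C[X]} (hf : IsQPolynomial F f) (a : C) :
    IsQPolynomial F (f - Polynomial.C a * f ^ Nat.card F) := by
  intro n hn
  rw [coeff_sub, coeff_C_mul] at hn
  by_cases h : f.coeff n = 0
  · have h' : (f ^ Nat.card F).coeff n ≠ 0 := fun h0 => hn (by rw [h, h0, mul_zero, sub_zero])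
    obtain ⟨k, rfl, hk⟩ := exists_of_coeff_pow_card_ne_zero F h'
    obtain ⟨i, rfl⟩ := hf k hk
    exact ⟨i + 1, (pow_succ _ _).symm⟩
  · exact hf n h

lemma coeff_one_sub_C_mul_pow (f : C[X]) (a : C) :
    (f - Polynomial.C a * f ^ Nat.card F).coeff 1 = f.coeff 1 := by
  have h : (f ^ Nat.card F).coeff 1 = 0 := by
    by_contra h
    obtain ⟨k, hk, -⟩ := exists_of_coeff_pow_card_ne_zero F h
    have := one_lt_card F
    exact this.ne' (Nat.eq_one_of_mul_eq_one_left hk.symm)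
  rw [coeff_sub, coeff_C_mul, h, mul_zero, sub_zero]

end QPolynomials

section Linear

open Polynomial Filter Topology

lemma norm_algebraMap_eq_one {F C : Type*} [Field F] [Finite F] [NormedField C] [Algebra F C]
    {c : F} (hc : c ≠ 0) : ‖algebraMap F C c‖ = 1 := by
  obtain ⟨n, hn, h⟩ := isOfFinOrder_iff_pow_eq_one.mp (isOfFinOrder_of_finite (Units.mk0 c hc))
  have h' : c ^ n = 1 := by simpa [Units.ext_iff] using h
  have : ‖algebraMap F C c‖ ^ n = 1 := by rw [← norm_pow, ← map_pow, h', map_one, norm_one]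
  exact (pow_eq_one_iff_of_nonneg (norm_nonneg _) hn.ne').mp this

variable {F C : Type*} [Field F] [Finite F] [NormedField C] [IsUltrametricDist C]
  [CompleteSpace C] [Algebra F C]

/-- The factor at `c y` is `-c⁻¹ (z/y - c)`. Wilson's theorem evaluates the product of the constants
`-c⁻¹` to `-1`, and the rest is the factorization of `T ^ q - T` at `T = z/y`. -/
lemma expFn_span_singleton (y z : C) :
    expFn (Submodule.span F {y} : Set C) z = z - (y ^ (Nat.card F - 1))⁻¹ * z ^ Nat.card F := by
  classical
  have hq := one_lt_card F
  have : Fintype F := Fintype.ofFinite F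
  have : Finite (Submodule.span F {y}) := Module.finite_of_finite F
  have : Fintype (Submodule.span F {y}) := Fintype.ofFinite _
  rw [expFn_eq_prod]
  -- The formula persists for `y = 0` because `0⁻¹ = 0`. This covers both the empty generating set
  -- and an added generator that already lies in the span.
  by_cases hy : y = 0
  · subst hy
    rw [Fintype.prod_eq_single (0 : Submodule.span F {(0 : C)}) fun l hl => absurd (Subtype.ext ?_) hl]
    · rw [Submodule.coe_zero, expFactor_zero, zero_pow (by omega), inv_zero, zero_mul, sub_zero]
    · obtain ⟨c, hc⟩ := Submodule.mem_span_singleton.mp l.2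
      rw [← hc, smul_zero]; rfl
  · have hbij : Function.Bijective fun c : F =>
        (⟨c • y, Submodule.smul_mem _ c (Submodule.mem_span_singleton_self y)⟩ :
          Submodule.span F {y}) := by
      constructor
      · intro c d hcd
        exact smul_left_injective F hy (congrArg Subtype.val hcd)
      · rintro ⟨w, hw⟩
        obtain ⟨c, hc⟩ := Submodule.mem_span_singleton.mp hw
        exact ⟨c, Subtype.ext hc⟩
    rw [← Fintype.prod_bijective _ hbij (fun c => expFactor z (c • y)) _ fun c => rfl,
      ← Finset.mul_prod_erase _ _ (Finset.mem_univ (0 : F)), zero_smul, expFactor_zero]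
    have h1 : ∀ c ∈ Finset.univ.erase (0 : F), expFactor z (c • y) =
        (-algebraMap F C c⁻¹) * (z / y - algebraMap F C c) := by
      intro c hc
      have hc0 : algebraMap F C c ≠ 0 := by simpa using Finset.ne_of_mem_erase hc
      rw [expFactor_of_ne_zero _ (smul_ne_zero (Finset.ne_of_mem_erase hc) hy), map_inv₀,
        Algebra.smul_def]
      field_simp
      ring
    have h2 : ∏ c ∈ Finset.univ.erase (0 : F), -algebraMap F C c⁻¹ = -1 := by
      have hW := FiniteField.prod_univ_units_id_eq_neg_one (K := F)
      have h3 : ∏ c ∈ Finset.univ.erase (0 : F), (-c⁻¹) = -1 := by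
        calc ∏ c ∈ Finset.univ.erase (0 : F), (-c⁻¹) = ∏ u : Fˣ, (u : F) := by
              refine Finset.prod_bij' (fun c hc => Units.mk0 (-c⁻¹)
                  (neg_ne_zero.mpr (inv_ne_zero (Finset.ne_of_mem_erase hc))))
                (fun u _ => -(u : F)⁻¹) (fun _ _ => Finset.mem_univ _)
                (fun u _ => by simp) (fun c hc => by simp) (fun u _ => by ext; simp)
                (fun c _ => rfl)
          _ = -1 := by rw [← Units.coe_prod, hW]; rfl
      have h4 := congrArg (algebraMap F C) h3
      simpa [map_prod] using h4
    have h5 := prod_sub_algebraMap (F := F) (z / y)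
    rw [← Finset.mul_prod_erase _ _ (Finset.mem_univ (0 : F)), map_zero, sub_zero] at h5
    rw [Finset.prod_congr rfl h1, Finset.prod_mul_distrib, h2]
    have h6 : y ^ Nat.card F = y * y ^ (Nat.card F - 1) := by
      rw [← pow_succ']; congr 1; omega
    have h7 : z * (-1 * ∏ c ∈ Finset.univ.erase (0 : F), (z / y - algebraMap F C c))
        = -y * (z / y * ∏ c ∈ Finset.univ.erase (0 : F), (z / y - algebraMap F C c)) := by
      field_simp
    rw [h7, h5, div_pow, h6]
    field_simp
    ring

variable (F) in
/-- The exponential function of a finite subspace is a `q`-polynomial. -/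
lemma exists_isQPolynomial_span (s : Finset C) :
    ∃ f : C[X], IsQPolynomial F f ∧ f.coeff 1 = 1 ∧
      ∀ z, f.eval z = expFn (Submodule.span F (s : Set C) : Set C) z := by
  classical
  induction s using Finset.induction_on with
  | empty =>
    refine ⟨X, fun n hn => ⟨0, ?_⟩, coeff_X_one, fun z => ?_⟩
    · rw [pow_zero]
      by_contra h
      exact hn (coeff_X_of_ne_one h)
    · have h := expFn_span_singleton (F := F) 0 z
      rw [zero_pow (by have := one_lt_card F; omega), inv_zero, zero_mul, sub_zero,
        Submodule.span_zero_singleton] at h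
      rw [Finset.coe_empty, Submodule.span_empty, h, eval_X]
  | insert x s hx ih =>
    obtain ⟨f, hf, hf1, hfe⟩ := ih
    have : Finite (Submodule.span F ((insert x s : Finset C) : Set C)) := Module.finite_of_finite F
    have : Finite (Submodule.span F ((insert x s : Finset C) : Set C) ⧸
        (Submodule.span F (s : Set C)).submoduleOf
          (Submodule.span F ((insert x s : Finset C) : Set C))) :=
      Finite.of_surjective _ (Submodule.mkQ_surjective _)
    refine ⟨_, hf.sub_C_mul_pow ((f.eval x) ^ (Nat.card F - 1))⁻¹, ?_, fun z => ?_⟩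
    · rw [coeff_one_sub_C_mul_pow, hf1]
    · rw [expFn_comp (isStronglyDiscrete_of_finite (Set.toFinite _))
        (Submodule.span_mono (Finset.coe_subset.mpr (Finset.subset_insert x s))) hf.toLinearMap hfe]
      -- The polynomial for `s` kills the span of `s`, so the image of the enlarged space is the
      -- line through `f(x)`.
      have hmap : (Submodule.span F ((insert x s : Finset C) : Set C)).map hf.toLinearMap =
          Submodule.span F {f.eval x} := by
        rw [Submodule.map_span, Finset.coe_insert, Set.image_insert_eq, Submodule.span_insert,
          hf.toLinearMap_apply]
        refine sup_eq_left.mpr (Submodule.span_le.mpr ?_)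
        rintro _ ⟨y, hy, rfl⟩
        have : Finite (Submodule.span F (s : Set C)) := Module.finite_of_finite F
        have h0 : f.eval y = 0 := by
          rw [hfe, expFn_eq_zero_iff (isStronglyDiscrete_of_finite (Set.toFinite _))
            (Submodule.zero_mem _)]
          exact Submodule.subset_span hy
        rw [hf.toLinearMap_apply, h0]
        exact Submodule.zero_mem _
      rw [hmap, expFn_span_singleton, hf.toLinearMap_apply, eval_sub, eval_mul, eval_C, eval_pow]

lemma exists_isQPolynomial (W : Submodule F C) [Finite W] :
    ∃ f : C[X], IsQPolynomial F f ∧ f.coeff 1 = 1 ∧ ∀ z, f.eval z = expFn (W : Set C) z := by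
  have hW : (W : Set C).Finite := Set.toFinite _
  have := exists_isQPolynomial_span F hW.toFinset
  rwa [Set.Finite.coe_toFinset, Submodule.span_eq] at this

/-- The exponential function of a strongly discrete `F`-subspace is `F`-linear. -/
lemma exists_linearMap_eq_expFn {Λ : Submodule F C} (h : IsStronglyDiscrete (Λ : Set C)) :
    ∃ e : C →ₗ[F] C, ∀ z, e z = expFn (Λ : Set C) z := by
  classical
  -- Balls in `Λ` are `F`-subspaces by the ultrametric inequality and because nonzero constants have
  -- norm `1`. They are finite and exhaust `Λ`, so linearity passes to the limit.
  let W : ℕ → Submodule F C := fun n =>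
    { carrier := {l | l ∈ Λ ∧ ‖l‖ ≤ n}
      add_mem' := fun {a b} ha hb => ⟨add_mem ha.1 hb.1,
        (IsUltrametricDist.norm_add_le_max _ _).trans (max_le ha.2 hb.2)⟩
      zero_mem' := ⟨Λ.zero_mem, by simp⟩
      smul_mem' := fun c x hx => ⟨Λ.smul_mem c hx.1, by
        by_cases hc : c = 0
        · simp [hc]
        · rw [Algebra.smul_def, norm_mul, norm_algebraMap_eq_one hc, one_mul]; exact hx.2⟩ }
  have hfin : ∀ n, Finite (W n) := fun n => (h n).to_subtype
  have hfin' : ∀ n, Fintype (W n) := fun n => Fintype.ofFinite _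
  have hlin : ∀ n, ∃ e : C →ₗ[F] C, ∀ z, e z = expFn (W n : Set C) z := fun n => by
    obtain ⟨f, hf, -, hfe⟩ := exists_isQPolynomial (W n)
    exact ⟨hf.toLinearMap, hfe⟩
  choose e he using hlin
  have hlim : ∀ z, Tendsto (fun n => e n z) atTop (𝓝 (expFn (Λ : Set C) z)) := by
    intro z
    let i : ∀ n, W n ↪ (Λ : Set C) := fun n =>
      ⟨fun l => ⟨l, l.2.1⟩, fun a b hab => Subtype.ext (congrArg (fun x : (Λ : Set C) => (x : C)) hab)⟩
    have hs : Tendsto (fun n => Finset.univ.map (i n)) atTop (atTop : Filter (Finset (Λ : Set C))) := by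
      refine tendsto_atTop_finset_of_monotone (fun m n hmn l hl => ?_) fun l => ?_
      · obtain ⟨a, -, rfl⟩ := Finset.mem_map.mp hl
        exact Finset.mem_map.mpr ⟨⟨a, a.2.1, a.2.2.trans (Nat.cast_le.mpr hmn)⟩,
          Finset.mem_univ _, rfl⟩
      · obtain ⟨n, hn⟩ := exists_nat_ge ‖(l : C)‖
        exact ⟨n, Finset.mem_map.mpr ⟨⟨l, l.2, hn⟩, Finset.mem_univ _, rfl⟩⟩
    have hp : Tendsto (fun s : Finset (Λ : Set C) => ∏ l ∈ s, expFactor z l) atTop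
        (𝓝 (expFn (Λ : Set C) z)) := by
      rw [expFn_eq_tprod h Λ.zero_mem]
      simpa [HasProd] using (h.multipliable_expFactor z).hasProd
    refine (hp.comp hs).congr fun n => ?_
    rw [he, expFn_eq_prod, Function.comp_apply, Finset.prod_map]
    rfl
  refine ⟨{ toFun := expFn (Λ : Set C), map_add' := fun x y => ?_, map_smul' := fun c x => ?_ },
    fun z => rfl⟩
  · refine tendsto_nhds_unique (hlim (x + y)) ?_
    simp_rw [map_add]
    exact (hlim x).add (hlim y)
  · refine tendsto_nhds_unique (hlim (c • x)) ?_
    simp_rw [map_smul, Algebra.smul_def]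
    exact (hlim x).const_mul _

end Linear

/-! ### The polynomial of a pair of discrete subspaces -/

section Isogeny

open Polynomial Filter Topology

variable {F C : Type*} [Field F] [NormedField C] [IsUltrametricDist C]
  [CompleteSpace C] [Algebra F C]

/-- Nonzero elements of `Λ` are bounded away from `0`, so `e` is injective on the small powers of
`π`. This supplies the infinitely many values that make the polynomial attached to a lattice pair
unique. -/
lemma infinite_range_of_eq_expFn {Λ : Submodule F C} (h : IsStronglyDiscrete (Λ : Set C))
    {e : C →ₗ[F] C} (he : ∀ z, e z = expFn (Λ : Set C) z) {π : C} (hπ0 : π ≠ 0) (hπ : ‖π‖ < 1) :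
    (Set.range e).Infinite := by
  have hπ0' : 0 < ‖π‖ := norm_pos_iff.mpr hπ0
  obtain ⟨δ, hδ, hδΛ⟩ : ∃ δ > 0, ∀ l ∈ Λ, ‖l‖ < δ → l = 0 := by
    have hfin : ({l | l ∈ Λ ∧ ‖l‖ ≤ 1} \ {0}).Finite := (h 1).subset Set.sdiff_subset
    obtain ⟨δ, hδ, hlt⟩ : ∃ δ > 0, ∀ l ∈ {l | l ∈ Λ ∧ ‖l‖ ≤ 1} \ {0}, δ ≤ ‖l‖ := by
      rcases ({l | l ∈ Λ ∧ ‖l‖ ≤ 1} \ {0}).eq_empty_or_nonempty with he | hne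
      · exact ⟨1, one_pos, fun l hl => by rw [he] at hl; exact hl.elim⟩
      · obtain ⟨l₀, hl₀, hmin⟩ := Set.exists_min_image _ norm hfin hne
        exact ⟨‖l₀‖, norm_pos_iff.mpr hl₀.2, hmin⟩
    refine ⟨min δ 1, lt_min hδ one_pos, fun l hl hlδ => ?_⟩
    by_contra h0
    exact (hlδ.trans_le (min_le_left _ _)).not_ge
      (hlt l ⟨⟨hl, (hlδ.trans_le (min_le_right _ _)).le⟩, h0⟩)
  obtain ⟨n₀, hn₀⟩ := exists_pow_lt_of_lt_one hδ hπ
  have hsmall : ∀ n, ‖π ^ (n₀ + n)‖ < δ := fun n => by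
    rw [norm_pow]
    exact (pow_le_pow_of_le_one hπ0'.le hπ.le (Nat.le_add_right _ _)).trans_lt hn₀
  refine Set.infinite_of_injective_forall_mem (f := fun n : ℕ => e (π ^ (n₀ + n)))
    (fun a b hab => ?_) fun n => ⟨_, rfl⟩
  have hab' : e (π ^ (n₀ + a) - π ^ (n₀ + b)) = 0 := by
    rw [map_sub]; exact sub_eq_zero.mpr hab
  rw [he, expFn_eq_zero_iff h Λ.zero_mem] at hab'
  have h1 := hδΛ _ hab' (by
    rw [sub_eq_add_neg]
    refine (IsUltrametricDist.norm_add_le_max _ _).trans_lt (max_lt (hsmall a) ?_)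
    rw [norm_neg]; exact hsmall b)
  have h2 : ‖π‖ ^ (n₀ + a) = ‖π‖ ^ (n₀ + b) := by
    rw [← norm_pow, ← norm_pow, sub_eq_zero.mp h1]
  have := pow_right_injective₀ hπ0' hπ.ne h2
  simpa using this


/-- A polynomial that coincides with the exponential function of a finite subspace `W` has simple
zeros in the elements of `W` and the linear coefficient `1`. -/
lemma leadingCoeff_of_eval_eq_expFn [Infinite C] (W : Submodule F C) [Finite W] {f : C[X]}
    (hf : ∀ z, f.eval z = expFn (W : Set C) z) :
    f.natDegree = Nat.card W ∧
      (∀ z, f.leadingCoeff * ∏ᶠ w ∈ (W : Set C), (z - w) = f.eval z) ∧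
      f.leadingCoeff * ∏ᶠ w ∈ (W : Set C) \ {0}, w = 1 := by
  classical
  have hfin : (W : Set C).Finite := Set.toFinite _
  set s := hfin.toFinset with hs
  have hsW : ∀ w, w ∈ s ↔ w ∈ W := fun w => hfin.mem_toFinset
  have h0 : (0 : C) ∈ s := (hsW 0).mpr W.zero_mem
  have := Fintype.ofFinite W
  -- The constant comes from `1 - z/w = -w⁻¹ (z - w)`; it turns out to be the leading coefficient.
  set D := ∏ w ∈ s.erase 0, -w⁻¹ with hD
  have hD0 : D ≠ 0 := Finset.prod_ne_zero_iff.mpr fun w hw =>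
    neg_ne_zero.mpr (inv_ne_zero (Finset.ne_of_mem_erase hw))
  have heval : ∀ z, f.eval z = D * ∏ w ∈ s, (z - w) := fun z => by
    have h1 : ∏ l : W, expFactor z l = ∏ l ∈ s, expFactor z l :=
      (Finset.prod_subtype s hsW (expFactor z)).symm
    rw [hf, expFn_eq_prod W, h1, ← Finset.mul_prod_erase _ _ h0, expFactor_zero,
      ← Finset.mul_prod_erase _ (fun w => z - w) h0, sub_zero, hD, mul_left_comm,
      ← Finset.prod_mul_distrib]
    congr 1
    refine Finset.prod_congr rfl fun w hw => ?_
    have hw0 : w ≠ 0 := Finset.ne_of_mem_erase hw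
    rw [expFactor_of_ne_zero z hw0]
    field_simp
    ring
  have hpoly : f = Polynomial.C D * ∏ w ∈ s, (X - Polynomial.C w) := by
    refine Polynomial.funext fun z => ?_
    rw [heval, eval_mul, eval_C, eval_prod]
    simp
  have hmonic : (∏ w ∈ s, (X - Polynomial.C w)).Monic :=
    monic_prod_of_monic _ _ fun w _ => monic_X_sub_C w
  have hlc : f.leadingCoeff = D := by
    rw [hpoly, leadingCoeff_mul, leadingCoeff_C, hmonic.leadingCoeff, mul_one]
  refine ⟨?_, fun z => ?_, ?_⟩
  · rw [hpoly, natDegree_C_mul hD0, natDegree_finsetProd_X_sub_C_eq_card]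
    exact (Nat.card_eq_card_finite_toFinset hfin).symm
  · rw [hlc, heval, finprod_mem_eq_finite_toFinset_prod _ hfin]
  · have h1 : (W : Set C) \ {0} = (s.erase 0 : Finset C) := by
      ext w; simp [hsW]
    -- The signs disappear on reindexing by `w ↦ -w`, with no distinction between odd and even
    -- characteristic.
    have h2 : ∏ w ∈ s.erase 0, -w⁻¹ = ∏ w ∈ s.erase 0, w⁻¹ :=
      Finset.prod_nbij' (fun w => -w) (fun w => -w)
        (fun w hw => by simpa [hsW] using hw) (fun w hw => by simpa [hsW] using hw)
        (fun w _ => neg_neg w) (fun w _ => neg_neg w) (fun w _ => by rw [inv_neg])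
    rw [hlc, h1, finprod_mem_coe_finset, hD, h2, ← Finset.prod_mul_distrib]
    exact Finset.prod_eq_one fun w hw => inv_mul_cancel₀ (Finset.ne_of_mem_erase hw)

/-- The polynomial attached to a pair `Λ ⊆ Λ'` of strongly discrete subspaces. -/
lemma exists_isogeny [Finite F] [Infinite C] {Λ Λ' : Submodule F C}
    (h : IsStronglyDiscrete (Λ' : Set C))
    (hle : Λ ≤ Λ') [Finite (Λ' ⧸ Λ.submoduleOf Λ')] {e : C →ₗ[F] C}
    (he : ∀ z, e z = expFn (Λ : Set C) z) :
    ∃ f : C[X], IsQPolynomial F f ∧ f.coeff 1 = 1 ∧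
      f.natDegree = Nat.card (Λ' ⧸ Λ.submoduleOf Λ') ∧
      (∀ z, expFn (Λ' : Set C) z = f.eval (e z)) ∧
      (∀ z, f.leadingCoeff * ∏ᶠ w ∈ e '' (Λ' : Set C), (z - w) = f.eval z) ∧
      f.leadingCoeff * ∏ᶠ w ∈ e '' (Λ' : Set C) \ {0}, w = 1 := by
  -- Since the kernel of `e` is `Λ`, the image of `Λ'` has `[Λ' : Λ]` elements, which gives the
  -- degree.
  have hker : LinearMap.ker (e.submoduleMap Λ') = Λ.submoduleOf Λ' := by
    ext x
    rw [LinearMap.mem_ker, ← Subtype.coe_inj]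
    change e x = 0 ↔ (x : C) ∈ Λ
    rw [he]
    exact expFn_eq_zero_iff (h.mono hle) Λ.zero_mem
  let E := (Submodule.quotEquivOfEq _ _ hker.symm).trans
    ((e.submoduleMap Λ').quotKerEquivOfSurjective (e.submoduleMap_surjective Λ'))
  have hfin : Finite (Λ'.map e) := Finite.of_equiv _ E.toEquiv
  obtain ⟨f, hf, hf1, hfe⟩ := exists_isQPolynomial (Λ'.map e)
  obtain ⟨h1, h2, h3⟩ := leadingCoeff_of_eval_eq_expFn (Λ'.map e) hfe
  refine ⟨f, hf, hf1, ?_, fun z => ?_, h2, h3⟩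
  · rw [h1, Nat.card_congr E.toEquiv]
  · rw [expFn_comp h hle e he, hfe]

end Isogeny

/-! ### Lattices in `C_∞` -/

section LatticesInCInf

open IntermediateField

instance {K : Type*} [Field K] (P : Place K) : IsUltrametricDist P.CInf :=
  IsUltrametricDist.of_normedAlgebra P.KInf

variable {K : Type*} [Field K] {P : Place K} {r : ℕ}

lemma norm_algebraMap_KInf (x : K) : ‖algebraMap K P.KInf x‖ = P.absVal x :=
  UniformSpace.Completion.norm_coe (E := WithAbs P.absVal) (WithAbs.toAbs P.absVal x)

/-- The vector of `K_∞ ^ r` given by a vector of `K ^ r`. -/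
def toKInf (y : Fin r → K) : Fin r → P.KInf := fun i => algebraMap K P.KInf (y i)

lemma embed_eq (ω : Fin r → P.CInf) (y : Fin r → K) :
    embed ω y = ∑ i, toKInf (P := P) y i • ω i := by
  simp only [embed, Fintype.linearCombination_apply, toKInf, algebraMap_smul]

lemma absVal_le_norm_toKInf (y : Fin r → K) (i : Fin r) :
    P.absVal (y i) ≤ ‖toKInf (P := P) y‖ := by
  rw [← norm_algebraMap_KInf]; exact norm_le_pi_norm (toKInf (P := P) y) i

/-- An injective linear map on a finite-dimensional space over a complete field is bounded below.
Here independence over `K_∞`, and not only over `K`, is needed: it transfers discreteness from `V`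
to `C_∞`. -/
lemma exists_mul_norm_le {ω : Fin r → P.CInf} (hω : ω ∈ drinfeldSpace P r) :
    ∃ c > 0, ∀ x : Fin r → P.KInf, c * ‖x‖ ≤ ‖∑ i, x i • ω i‖ := by
  obtain ⟨c, hc, h⟩ := (Fintype.linearCombination P.KInf ω).exists_antilipschitzWith
    (LinearMap.ker_eq_bot.mpr (linearIndependent_iff_injective_fintypeLinearCombination.mp hω))
  refine ⟨(c : ℝ)⁻¹, by positivity, fun x => ?_⟩
  have := h.le_mul_dist x 0
  rw [map_zero, dist_zero_right, dist_zero_right, Fintype.linearCombination_apply] at this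
  rw [inv_mul_le_iff₀ (by positivity)]
  exact this

lemma embed_injective {ω : Fin r → P.CInf} (hω : ω ∈ drinfeldSpace P r) :
    Function.Injective (embed (P := P) ω) := by
  refine (injective_iff_map_eq_zero _).mpr fun y hy => ?_
  have h := Fintype.linearIndependent_iff.mp hω (toKInf y) (by rw [← embed_eq, hy])
  funext i
  exact (map_eq_zero (algebraMap K P.KInf)).mp (h i)

lemma embed_mem_image {Y : Lattice P r} {ω : Fin r → P.CInf} (hω : ω ∈ drinfeldSpace P r)
    {y : Fin r → K} : embed ω y ∈ Y.image ω ↔ y ∈ Y.1 :=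
  ⟨fun ⟨_, hy', h⟩ => embed_injective hω h ▸ hy', fun h => ⟨y, h, rfl⟩⟩

lemma image_mono {Y Y' : Lattice P r} (h : Y.1 ≤ Y'.1) (ω : Fin r → P.CInf) :
    Y.image ω ≤ Y'.image ω := Submodule.map_mono h

lemma exists_norm_lt_one (P : Place K) : ∃ π : P.CInf, π ≠ 0 ∧ ‖π‖ < 1 := by
  obtain ⟨x, hx⟩ := P.surjective (WithZero.exp (-1))
  have hx0 : x ≠ 0 := by
    rintro rfl; rw [map_zero] at hx; exact WithZero.exp_ne_zero hx.symm
  refine ⟨algebraMap P.KInf P.CInf (algebraMap K P.KInf x), ?_, ?_⟩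
  · exact (map_ne_zero _).mpr ((map_ne_zero _).mpr hx0)
  · rw [norm_algebraMap', norm_algebraMap_KInf, P.absVal_lt_one_iff, hx, ← WithZero.exp_zero,
      WithZero.exp_lt_exp]
    omega

instance : Infinite P.CInf := by
  obtain ⟨π, hπ0, hπ⟩ := exists_norm_lt_one P
  refine Infinite.of_injective (fun n : ℕ => π ^ n) fun a b hab => ?_
  refine pow_right_injective₀ (norm_pos_iff.mpr hπ0) hπ.ne ?_
  simpa using congrArg norm hab

lemma classesOver_eq {Y Y' : Lattice P r} (h : Y.1 ≤ Y'.1) (v : Fin r → K) :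
    classesOver h v = {x | Quotient.out x - v ∈ Y'.1} := by
  ext x
  conv_lhs => rw [← Quotient.out_eq x]
  exact Submodule.Quotient.eq _

lemma out_mem_iff {Y : Lattice P r} (x : (Fin r → K) ⧸ Y.1) : Quotient.out x ∈ Y.1 ↔ x = 0 := by
  rw [← Submodule.Quotient.mk_eq_zero]
  exact Eq.congr_left (Quotient.out_eq x)

lemma out_sub_mem {Y : Lattice P r} (v : Fin r → K) :
    Quotient.out (Submodule.Quotient.mk v : (Fin r → K) ⧸ Y.1) - v ∈ Y.1 :=
  (Submodule.Quotient.eq _).mp (Quotient.out_eq _)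

lemma discrFn_eq {F : Type*} {Y Y' : Lattice P r} {ω : Fin r → P.CInf} {φ : P.CInf[X]}
    (hφ : IsNormalizedIsogeny F (Y.image ω) (Y'.image ω) φ)
    (huniq : ∀ ψ, IsNormalizedIsogeny F (Y.image ω) (Y'.image ω) ψ → ψ = φ) :
    discrFn F Y Y' ω = φ.leadingCoeff := by
  have hex : ∃ φ, IsNormalizedIsogeny F (Y.image ω) (Y'.image ω) φ := ⟨φ, hφ⟩
  rw [discrFn, discr, dif_pos hex, huniq _ hex.choose_spec]

/-- A family of values `g (u, Y)` whose images under a separating family of evaluations satisfy the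
relations of a derived distribution is a derived distribution. -/
lemma isDerivedDistribution_of_eval {M I C : Type*} [CommGroup M] [Field C]
    (g : PuncturedDomain P r → M) (d : (Fin r → K) → Lattice P r → I → C)
    (Δ : Lattice P r → Lattice P r → I → C) (ev : I → M →* C)
    (hev : ∀ m m', (∀ i, ev i m = ev i m') → m = m')
    (hg : ∀ u Y hu i, ev i (g ⟨(u, Y), hu⟩) = d u Y i)
    (hd : ∀ (Y : Lattice P r) (u u' : Fin r → K) (i : I), u - u' ∈ Y.1 → d u Y i = d u' Y i)
    (hfin : ∀ {Y Y' : Lattice P r} (h : Y.1 ≤ Y'.1) (v : Fin r → K), (classesOver h v).Finite)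
    (hone : ∀ {Y Y' : Lattice P r} (h : Y.1 ≤ Y'.1) (i : I),
      Δ Y Y' i * (∏ᶠ x ∈ classesOver h 0 \ {0}, d x.out Y i) = 1)
    (hrel : ∀ {Y Y' : Lattice P r} (h : Y.1 ≤ Y'.1) (v : Fin r → K) (i : I),
      Δ Y Y' i * (∏ᶠ x ∈ classesOver h v, d x.out Y i) = d v Y' i) :
    IsDerivedDistribution g ∧
      ∀ (Y Y' : Lattice P r) (h : Y.1 ≤ Y'.1) (i : I), ev i (Disc g h) = Δ Y Y' i := by
  have hext : ∀ (u : Fin r → K) (Y : Lattice P r), u ∉ Y.1 → ∀ i,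
      ev i (extend g u Y) = d u Y i := fun u Y hu i => by
    rw [extend, dif_pos hu]
    exact hg u Y hu i
  have hext1 : ∀ (u : Fin r → K) (Y : Lattice P r), u ∈ Y.1 → extend g u Y = 1 :=
    fun u Y hu => by rw [extend, dif_neg (not_not.mpr hu)]
  -- Away from the zero class, representatives lie outside `Y`, so the default value `1` of `extend`
  -- is never met and evaluation gives `d`.
  have hprod : ∀ {Y Y' : Lattice P r} (h : Y.1 ≤ Y'.1) (v : Fin r → K)
      (s : Set ((Fin r → K) ⧸ Y.1)), s ⊆ classesOver h v → (0 : (Fin r → K) ⧸ Y.1) ∉ s → ∀ i,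
      ev i (∏ᶠ x ∈ s, onClasses g Y x) = ∏ᶠ x ∈ s, d x.out Y i := by
    intro Y Y' h v s hs h0 i
    rw [MonoidHom.map_finprod_mem _ _ ((hfin h v).subset hs)]
    refine finprod_mem_congr rfl fun x hx => hext _ _ (fun hmem => h0 ?_) i
    rwa [← (out_mem_iff x).mp hmem]
  have hdisc : ∀ (Y Y' : Lattice P r) (h : Y.1 ≤ Y'.1) (i : I), ev i (Disc g h) = Δ Y Y' i := by
    intro Y Y' h i
    have h1 := hone h i
    rw [← hprod h 0 (classesOver h 0 \ {0}) Set.sdiff_subset (fun h0 => h0.2 rfl) i] at h1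
    have h2 : ev i (Disc g h) * ev i (∏ᶠ x ∈ classesOver h 0 \ {0}, onClasses g Y x) = 1 := by
      rw [← map_mul, Disc, inv_mul_cancel, map_one]
    exact mul_right_cancel₀ (right_ne_zero_of_mul (h1 ▸ one_ne_zero)) (h2.trans h1.symm)
  refine ⟨⟨fun Y u u' hu hu' huu' => hev _ _ fun i => ?_, fun Y Y' h v => ?_⟩, hdisc⟩
  · rw [hg, hg, hd Y u u' i huu']
  -- For `v ∈ Y'` the relation is formal: the zero class contributes `1`, and the remaining product
  -- cancels against the discriminant. Only `v ∉ Y'` uses `hrel`.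
  · by_cases hv : v ∈ Y'.1
    · have hcl : classesOver h v = classesOver h 0 := by
        rw [classesOver_eq, classesOver_eq]
        ext x
        change _ - v ∈ Y'.1 ↔ _ - 0 ∈ Y'.1
        rw [sub_zero]
        exact Y'.1.sub_mem_iff_left hv
      have h0 : (0 : (Fin r → K) ⧸ Y.1) ∈ classesOver h 0 := map_zero (Submodule.factor h)
      rw [hext1 v Y' hv, hcl, Disc, ← finprod_mem_insert_of_eq_one_if_notMem
        (f := onClasses g Y) (a := (0 : (Fin r → K) ⧸ Y.1)) (s := classesOver h 0 \ {0})
        (fun _ => hext1 _ _ ((out_mem_iff _).mpr rfl)), Set.insert_sdiff_singleton,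
        Set.insert_eq_of_mem h0, mul_inv_cancel]
    · refine hev _ _ fun i => ?_
      have h0 : (0 : (Fin r → K) ⧸ Y.1) ∉ classesOver h v := fun h0 => hv (by
        rw [classesOver_eq] at h0
        have h0' : Quotient.out (0 : (Fin r → K) ⧸ Y.1) - v ∈ Y'.1 := h0
        exact (Y'.1.sub_mem_iff_right (h ((out_mem_iff _).mpr rfl))).mp h0')
      rw [map_mul, hprod h v _ subset_rfl h0 i, hdisc, hext v Y' hv, mul_comm, hrel]

/-! ### Exponential functions of lattices as linear maps over the constants -/

section OverConstants

variable {F : Type*} [Field F] [Finite F] [Algebra F K]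

variable (F P) in
/-- The structure of an algebra over the field of constants on `C_∞`. -/
abbrev constAlgebra : Algebra F P.CInf := ((algebraMap K P.CInf).comp (algebraMap F K)).toAlgebra

attribute [local instance 10] constAlgebra

variable (F) in
/-- An `A`-submodule of `C_∞` as a subspace over the field of constants. -/
def constSubmodule (Λ : Submodule P.coeffRing P.CInf) : Submodule F P.CInf where
  carrier := Λ
  add_mem' := Λ.add_mem
  zero_mem' := Λ.zero_mem
  smul_mem' c x hx := by
    have := Λ.smul_mem ⟨algebraMap F K c, algebraMap_mem_coeffRing P c⟩ hx
    rw [Subring.smul_def, Algebra.smul_def] at this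
    exact this

lemma isStronglyDiscrete_image
    (hfd : ∀ t : K, Transcendental F t → FiniteDimensional F⟮t⟯ K)
    (hF : ∀ x : K, IsAlgebraic F x → x ∈ Set.range (algebraMap F K)) (Y : Lattice P r)
    {ω : Fin r → P.CInf} (hω : ω ∈ drinfeldSpace P r) :
    IsStronglyDiscrete (Y.image ω : Set P.CInf) := by
  obtain ⟨c, hc, h⟩ := exists_mul_norm_le hω
  intro B
  refine ((Lattice.finite_absVal_le hfd hF Y (B / c)).image (embed ω)).subset ?_
  rintro _ ⟨⟨y, hy, rfl⟩, hB⟩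
  refine ⟨y, ⟨hy, fun i => ?_⟩, rfl⟩
  have hB' : ‖embed ω y‖ ≤ B := hB
  rw [embed_eq] at hB'
  rw [le_div_iff₀ hc, mul_comm]
  exact (mul_le_mul_of_nonneg_left (absVal_le_norm_toKInf y i) hc.le).trans ((h _).trans hB')

lemma multipliable_latticeExp
    (hfd : ∀ t : K, Transcendental F t → FiniteDimensional F⟮t⟯ K)
    (hF : ∀ x : K, IsAlgebraic F x → x ∈ Set.range (algebraMap F K)) (Y : Lattice P r)
    {ω : Fin r → P.CInf} (hω : ω ∈ drinfeldSpace P r) (z : P.CInf) :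
    Multipliable fun l : {l : P.CInf // l ∈ Y.image ω ∧ l ≠ 0} => 1 - z / (l : P.CInf) := by
  have h := ((isStronglyDiscrete_image hfd hF Y hω).mono (Λ := {l | l ∈ Y.image ω ∧ l ≠ 0})
    fun _ hl => hl.1).multipliable_one_sub z 0
  simp_rw [zero_add] at h
  exact h

lemma exists_linearMap_eq_latticeExp
    (hfd : ∀ t : K, Transcendental F t → FiniteDimensional F⟮t⟯ K)
    (hF : ∀ x : K, IsAlgebraic F x → x ∈ Set.range (algebraMap F K)) (Y : Lattice P r)
    {ω : Fin r → P.CInf} (hω : ω ∈ drinfeldSpace P r) :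
    ∃ e : P.CInf →ₗ[F] P.CInf, (∀ z, e z = latticeExp (Y.image ω) z) ∧
      ∀ z, e z = 0 ↔ z ∈ Y.image ω := by
  have hd := isStronglyDiscrete_image hfd hF Y hω
  obtain ⟨e, he⟩ := exists_linearMap_eq_expFn (Λ := constSubmodule F (Y.image ω)) hd
  refine ⟨e, he, fun z => ?_⟩
  rw [he]
  exact expFn_eq_zero_iff hd (Y.image ω).zero_mem

lemma divisionFn_eq_zero_iff
    (hfd : ∀ t : K, Transcendental F t → FiniteDimensional F⟮t⟯ K)
    (hF : ∀ x : K, IsAlgebraic F x → x ∈ Set.range (algebraMap F K)) (Y : Lattice P r)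
    {ω : Fin r → P.CInf} (hω : ω ∈ drinfeldSpace P r) (u : Fin r → K) :
    divisionFn u Y ω = 0 ↔ u ∈ Y.1 := by
  obtain ⟨e, he, hker⟩ := exists_linearMap_eq_latticeExp hfd hF Y hω
  rw [divisionFn, ← he, hker, embed_mem_image hω]

lemma divisionFn_congr
    (hfd : ∀ t : K, Transcendental F t → FiniteDimensional F⟮t⟯ K)
    (hF : ∀ x : K, IsAlgebraic F x → x ∈ Set.range (algebraMap F K)) (Y : Lattice P r)
    {ω : Fin r → P.CInf} (hω : ω ∈ drinfeldSpace P r) {u u' : Fin r → K} (h : u - u' ∈ Y.1) :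
    divisionFn u Y ω = divisionFn u' Y ω := by
  obtain ⟨e, he, hker⟩ := exists_linearMap_eq_latticeExp hfd hF Y hω
  rw [divisionFn, divisionFn, ← he, ← he, ← sub_eq_zero, ← map_sub, ← map_sub, hker]
  exact (embed_mem_image hω).mpr h

lemma finite_quotient_image
    (hfd : ∀ t : K, Transcendental F t → FiniteDimensional F⟮t⟯ K)
    (hF : ∀ x : K, IsAlgebraic F x → x ∈ Set.range (algebraMap F K)) (Y Y' : Lattice P r)
    (ω : Fin r → P.CInf) :
    Finite (Y'.image ω ⧸ (Y.image ω).submoduleOf (Y'.image ω)) := by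
  have := Lattice.finite_quotient hfd hF Y Y'
  let f : Y'.1 →ₗ[P.coeffRing] Y'.image ω :=
    ((embed ω).restrictScalars P.coeffRing).submoduleMap Y'.1
  have hf : Function.Surjective f := LinearMap.submoduleMap_surjective _ _
  have hle : Y.1.submoduleOf Y'.1 ≤ ((Y.image ω).submoduleOf (Y'.image ω)).comap f :=
    fun y hy => ⟨y, hy, rfl⟩
  refine Finite.of_surjective (Submodule.mapQ _ _ f hle) fun x => ?_
  induction x using Submodule.Quotient.induction_on with
  | _ x =>
    obtain ⟨y, rfl⟩ := hf x
    exact ⟨Submodule.Quotient.mk y, rfl⟩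

lemma existsUnique_isogeny
    (hfd : ∀ t : K, Transcendental F t → FiniteDimensional F⟮t⟯ K)
    (hF : ∀ x : K, IsAlgebraic F x → x ∈ Set.range (algebraMap F K)) {Y Y' : Lattice P r}
    (h : Y.1 ≤ Y'.1) {ω : Fin r → P.CInf} (hω : ω ∈ drinfeldSpace P r) :
    ∃ φ : P.CInf[X], IsNormalizedIsogeny F (Y.image ω) (Y'.image ω) φ ∧
      (∀ ψ, IsNormalizedIsogeny F (Y.image ω) (Y'.image ω) ψ → ψ = φ) ∧
      (∀ z, φ.leadingCoeff * ∏ᶠ w ∈ latticeExp (Y.image ω) '' (Y'.image ω : Set P.CInf), (z - w)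
        = φ.eval z) ∧
      φ.leadingCoeff *
        ∏ᶠ w ∈ latticeExp (Y.image ω) '' (Y'.image ω : Set P.CInf) \ {0}, w = 1 := by
  have hd := isStronglyDiscrete_image hfd hF Y hω
  obtain ⟨e, he, hker⟩ := exists_linearMap_eq_latticeExp hfd hF Y hω
  have hfin : Finite (constSubmodule F (Y'.image ω) ⧸
      (constSubmodule F (Y.image ω)).submoduleOf (constSubmodule F (Y'.image ω))) :=
    finite_quotient_image hfd hF Y Y' ω
  obtain ⟨φ, h1, h2, h3, h4, h5, h6⟩ := exists_isogeny (Λ := constSubmodule F (Y.image ω))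
    (Λ' := constSubmodule F (Y'.image ω)) (isStronglyDiscrete_image hfd hF Y' hω)
    (image_mono h ω) he
  have hee : (e : P.CInf → P.CInf) = latticeExp (Y.image ω) := funext he
  rw [hee] at h5 h6
  have h4' : ∀ z, latticeExp (Y'.image ω) z = φ.eval (latticeExp (Y.image ω) z) := fun z => by
    rw [← he]; exact h4 z
  refine ⟨φ, ⟨h1, h2, h3, h4'⟩, fun ψ hψ => ?_, h5, h6⟩
  obtain ⟨π, hπ0, hπ⟩ := exists_norm_lt_one P
  have hinf := infinite_range_of_eq_expFn (Λ := constSubmodule F (Y.image ω)) hd he hπ0 hπ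
  refine Polynomial.eq_of_infinite_eval_eq ψ φ (hinf.mono ?_)
  rintro _ ⟨z, rfl⟩
  change ψ.eval (e z) = φ.eval (e z)
  rw [he, ← h4', hψ.exp_eq]

/-- By linearity `e(vω) - e(xω) = e((v - x)ω)`, with `v - x` running through `Y'` modulo `Y`. So the
factors `d_x` become the linear factors of `φ`, evaluated at `e(vω)`. -/
lemma bijOn_classesOver
    (hfd : ∀ t : K, Transcendental F t → FiniteDimensional F⟮t⟯ K)
    (hF : ∀ x : K, IsAlgebraic F x → x ∈ Set.range (algebraMap F K)) {Y Y' : Lattice P r}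
    (h : Y.1 ≤ Y'.1) {ω : Fin r → P.CInf} (hω : ω ∈ drinfeldSpace P r) (v : Fin r → K) :
    Set.BijOn (fun x : (Fin r → K) ⧸ Y.1 => divisionFn v Y ω - divisionFn x.out Y ω)
      (classesOver h v) (latticeExp (Y.image ω) '' (Y'.image ω : Set P.CInf)) := by
  obtain ⟨e, he, hker⟩ := exists_linearMap_eq_latticeExp hfd hF Y hω
  have hdiv : ∀ u, divisionFn u Y ω = e (embed ω u) := fun u => (he _).symm
  simp_rw [hdiv]
  rw [classesOver_eq]
  refine ⟨fun x hx => ?_, fun x _ y _ hxy => ?_, ?_⟩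
  · refine ⟨embed ω (v - x.out), ⟨_, ?_, rfl⟩, ?_⟩
    · rw [← neg_sub]; exact Y'.1.neg_mem hx
    · rw [← he, map_sub, map_sub]
  · have h1 : e (embed ω x.out) = e (embed ω y.out) := sub_right_injective hxy
    rw [← sub_eq_zero, ← map_sub, ← map_sub, hker, embed_mem_image hω] at h1
    rw [← Quotient.out_eq x, ← Quotient.out_eq y]
    exact (Submodule.Quotient.eq _).mpr h1
  · rintro _ ⟨_, ⟨y, hy, rfl⟩, rfl⟩
    have h1 := out_sub_mem (Y := Y) (v - y)
    refine ⟨Submodule.Quotient.mk (v - y), ?_, ?_⟩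
    · have : Quotient.out (Submodule.Quotient.mk (v - y) : (Fin r → K) ⧸ Y.1) - v =
        (Quotient.out (Submodule.Quotient.mk (v - y) : (Fin r → K) ⧸ Y.1) - (v - y)) - y := by abel
      change _ - v ∈ Y'.1
      rw [this]
      exact Y'.1.sub_mem (h h1) hy
    · have h2 := (hker (embed ω _)).mpr ((embed_mem_image hω).mpr h1)
      rw [map_sub, map_sub, sub_eq_zero] at h2
      change e (embed ω v) - e (embed ω _) = latticeExp (Y.image ω) (embed ω y)
      rw [h2, map_sub, map_sub, sub_sub_cancel, he]

lemma finite_classesOver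
    (hfd : ∀ t : K, Transcendental F t → FiniteDimensional F⟮t⟯ K)
    (hF : ∀ x : K, IsAlgebraic F x → x ∈ Set.range (algebraMap F K)) {Y Y' : Lattice P r}
    (h : Y.1 ≤ Y'.1) (v : Fin r → K) : (classesOver h v).Finite := by
  have := Lattice.finite_quotient hfd hF Y Y'
  let f : (Y'.1 ⧸ Y.1.submoduleOf Y'.1) → (Fin r → K) ⧸ Y.1 := fun x =>
    Submodule.Quotient.mk (v + (x.out : Fin r → K))
  refine (Set.finite_range f).subset fun x hx => ?_
  rw [classesOver_eq] at hx
  refine ⟨Submodule.Quotient.mk ⟨_, hx⟩, ?_⟩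
  have h1 : ((Quotient.out (Submodule.Quotient.mk ⟨_, hx⟩ : Y'.1 ⧸ Y.1.submoduleOf Y'.1) : Y'.1) :
      Fin r → K) - (Quotient.out x - v) ∈ Y.1 :=
    (Submodule.Quotient.eq (Y.1.submoduleOf Y'.1)).mp (Quotient.out_eq _)
  refine Eq.trans ((Submodule.Quotient.eq _).mpr ?_) (Quotient.out_eq x)
  convert h1 using 1
  abel

/-- Both sides are `φ(e(vω))`: on the left factored over its zeros, on the right through `e^{Y'_ω} =
φ ∘ e`. -/
lemma discrFn_mul_finprod_divisionFn
    (hfd : ∀ t : K, Transcendental F t → FiniteDimensional F⟮t⟯ K)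
    (hF : ∀ x : K, IsAlgebraic F x → x ∈ Set.range (algebraMap F K)) {Y Y' : Lattice P r}
    (h : Y.1 ≤ Y'.1) {ω : Fin r → P.CInf} (hω : ω ∈ drinfeldSpace P r) (v : Fin r → K) :
    discrFn F Y Y' ω * (∏ᶠ x ∈ classesOver h v, divisionFn x.out Y ω) = divisionFn v Y' ω := by
  obtain ⟨φ, hφ, huniq, h1, -⟩ := existsUnique_isogeny hfd hF h hω
  rw [discrFn_eq hφ huniq]
  have h2 : ∏ᶠ x ∈ classesOver h v, divisionFn x.out Y ω =
      ∏ᶠ w ∈ latticeExp (Y.image ω) '' (Y'.image ω : Set P.CInf), (divisionFn v Y ω - w) :=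
    finprod_mem_eq_of_bijOn _ (bijOn_classesOver hfd hF h hω v) fun x _ =>
      (sub_sub_cancel _ _).symm
  rw [h2, h1]
  exact (hφ.exp_eq _).symm

/-- The normalization of the linear coefficient of `φ`, rewritten as a product of division values.
It identifies the abstract discriminant with `Δ`. -/
lemma discrFn_mul_finprod_divisionFn_eq_one
    (hfd : ∀ t : K, Transcendental F t → FiniteDimensional F⟮t⟯ K)
    (hF : ∀ x : K, IsAlgebraic F x → x ∈ Set.range (algebraMap F K)) {Y Y' : Lattice P r}
    (h : Y.1 ≤ Y'.1) {ω : Fin r → P.CInf} (hω : ω ∈ drinfeldSpace P r) :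
    discrFn F Y Y' ω * (∏ᶠ x ∈ classesOver h 0 \ {0}, divisionFn x.out Y ω) = 1 := by
  obtain ⟨φ, hφ, huniq, -, h1⟩ := existsUnique_isogeny hfd hF h hω
  obtain ⟨e, he, hker⟩ := exists_linearMap_eq_latticeExp hfd hF Y hω
  rw [discrFn_eq hφ huniq]
  have hb := bijOn_classesOver hfd hF h hω 0
  have h0 : divisionFn (0 : Fin r → K) Y ω = 0 :=
    (divisionFn_eq_zero_iff hfd hF Y hω 0).mpr Y.1.zero_mem
  -- For `v = 0` the bijection of `bijOn_classesOver` sends `x` to `-d_x`; composition with negation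
  -- corrects the sign.
  have hneg : Set.BijOn (fun x : P.CInf => -x)
      (latticeExp (Y.image ω) '' (Y'.image ω : Set P.CInf) \ {0})
      (latticeExp (Y.image ω) '' (Y'.image ω : Set P.CInf) \ {0}) := by
    have hm : Set.MapsTo (fun x : P.CInf => -x)
        (latticeExp (Y.image ω) '' (Y'.image ω : Set P.CInf) \ {0})
        (latticeExp (Y.image ω) '' (Y'.image ω : Set P.CInf) \ {0}) := by
      rintro _ ⟨⟨z, hz, rfl⟩, hz0⟩
      refine ⟨⟨-z, neg_mem hz, ?_⟩, neg_ne_zero.mpr hz0⟩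
      rw [← he, ← he, map_neg]
    exact ⟨hm, neg_injective.injOn, fun x hx => ⟨-x, hm hx, neg_neg x⟩⟩
  have hb' : Set.BijOn (fun x : (Fin r → K) ⧸ Y.1 => divisionFn (0 : Fin r → K) Y ω
      - divisionFn x.out Y ω) (classesOver h 0 \ {0})
      (latticeExp (Y.image ω) '' (Y'.image ω : Set P.CInf) \ {0}) := by
    have hz : ∀ x : (Fin r → K) ⧸ Y.1, divisionFn (0 : Fin r → K) Y ω - divisionFn x.out Y ω = 0 ↔
        x = 0 := fun x => by
      rw [h0, zero_sub, neg_eq_zero, divisionFn_eq_zero_iff hfd hF Y hω, out_mem_iff]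
    refine ⟨fun x hx => ⟨hb.mapsTo hx.1, fun hx0 => hx.2 ((hz x).mp hx0)⟩,
      hb.injOn.mono Set.sdiff_subset, fun w hw => ?_⟩
    obtain ⟨x, hx, hxw⟩ := hb.surjOn hw.1
    exact ⟨x, ⟨hx, fun hx0 => hw.2 (hxw ▸ (hz x).mpr hx0)⟩, hxw⟩
  rw [← h1]
  congr 1
  exact finprod_mem_eq_of_bijOn _ (hneg.comp hb') fun x _ => by
    change _ = -(divisionFn (0 : Fin r → K) Y ω - divisionFn x.out Y ω)
    rw [h0, zero_sub, neg_neg]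

end OverConstants

end LatticesInCInf

/-! ### Holomorphy of the division functions -/

section Holomorphy

open Filter Topology IntermediateField

variable {K : Type*} [Field K] {P : Place K} {r : ℕ}

lemma toKInf_ne_zero {y : Fin r → K} (hy : y ≠ 0) : toKInf (P := P) y ≠ 0 := fun h =>
  hy (funext fun i => (map_eq_zero (algebraMap K P.KInf)).mp (congrFun h i))

lemma toKInf_sub (y w : Fin r → K) :
    toKInf (P := P) (y - w) = toKInf y - toKInf w := funext fun i => map_sub _ (y i) (w i)

lemma embed_mem_regularFns (u : Fin r → K) :
    (fun ω : drinfeldSpace P r => embed ω.1 u) ∈ regularFns P r := by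
  have h : (fun ω : drinfeldSpace P r => embed ω.1 u) =
      ∑ i, algebraMap P.KInf P.CInf (toKInf u i) • fun ω : drinfeldSpace P r => ω.1 i := by
    funext ω
    rw [embed_eq, Finset.sum_apply]
    exact Finset.sum_congr rfl fun i _ => Algebra.smul_def _ _
  rw [h]
  refine sum_mem fun i _ => Subalgebra.smul_mem _ ?_ _
  exact Algebra.subset_adjoin (Set.mem_union_left _ ⟨i, rfl⟩)

/-- A nonzero linear form is a multiple of a unimodular one. -/
lemma exists_eq_smul_unimodular {y : Fin r → K} (hy : y ≠ 0) :
    ∃ (a : P.KInf) (l : Fin r → P.KInf), ‖a‖ = ‖toKInf (P := P) y‖ ∧ ‖l‖ = 1 ∧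
      ∀ ω : Fin r → P.CInf, embed ω y = algebraMap P.KInf P.CInf a * ∑ i, l i • ω i := by
  have hx := toKInf_ne_zero (P := P) hy
  obtain ⟨j, -⟩ := Function.ne_iff.mp hy
  -- Dividing by a coordinate of maximal norm, rather than by the norm, keeps the scalar inside
  -- `K_∞`.
  obtain ⟨i, -, hi⟩ := Finset.exists_max_image Finset.univ
    (fun i => ‖toKInf (P := P) y i‖) ⟨j, Finset.mem_univ j⟩
  have hn : ‖toKInf (P := P) y i‖ = ‖toKInf (P := P) y‖ := le_antisymm (norm_le_pi_norm _ i)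
    ((pi_norm_le_iff_of_nonneg (norm_nonneg _)).mpr fun k => hi k (Finset.mem_univ k))
  have h0 : toKInf (P := P) y i ≠ 0 := norm_ne_zero_iff.mp (hn ▸ norm_ne_zero_iff.mpr hx)
  refine ⟨toKInf y i, (toKInf (P := P) y i)⁻¹ • toKInf y, hn, ?_, fun ω => ?_⟩
  · rw [norm_smul, norm_inv, hn, inv_mul_cancel₀ (norm_ne_zero_iff.mpr hx)]
  · rw [embed_eq, ← Algebra.smul_def, Finset.smul_sum]
    refine Finset.sum_congr rfl fun k _ => ?_
    rw [smul_smul, Pi.smul_apply, smul_eq_mul, mul_inv_cancel_left₀ h0]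

lemma inv_embed_mem_regularFns {y : Fin r → K} (hy : y ≠ 0) :
    (fun ω : drinfeldSpace P r => (embed ω.1 y)⁻¹) ∈ regularFns P r := by
  obtain ⟨a, l, -, hl, h⟩ := exists_eq_smul_unimodular (P := P) hy
  have h' : (fun ω : drinfeldSpace P r => (embed ω.1 y)⁻¹) =
      (algebraMap P.KInf P.CInf a)⁻¹ • fun ω : drinfeldSpace P r => (∑ i, l i • ω.1 i)⁻¹ := by
    funext ω
    rw [h, mul_inv]
    rfl
  rw [h']
  refine Subalgebra.smul_mem _ ?_ _
  exact Algebra.subset_adjoin (Set.mem_union_right _ ⟨l, hl, rfl⟩)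

/-- A bound independent of `ω ∈ Ψ_n` that decays with `y`: the source of uniform convergence. -/
lemma norm_inv_embed_le {y : Fin r → K} (hy : y ≠ 0) {n : ℕ} {ω : drinfeldSpace P r}
    (hω : ω ∈ affinoid P r n) :
    ‖(embed ω.1 y)⁻¹‖ ≤ (P.qInf : ℝ) ^ n / ‖toKInf (P := P) y‖ := by
  obtain ⟨a, l, ha, hl, h⟩ := exists_eq_smul_unimodular (P := P) hy
  have hq : 0 < (P.qInf : ℝ) ^ n := pow_pos (zero_lt_one.trans P.one_lt_qInf) n
  rw [h, mul_inv, norm_mul, norm_inv, norm_algebraMap', ha, norm_inv, inv_mul_eq_div]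
  gcongr
  exact inv_le_of_inv_le₀ hq (hω.2 l hl)

lemma norm_embed_le (u : Fin r → K) {n : ℕ} {ω : drinfeldSpace P r} (hω : ω ∈ affinoid P r n) :
    ‖embed ω.1 u‖ ≤ ‖toKInf (P := P) u‖ * (P.qInf : ℝ) ^ n := by
  rw [embed_eq]
  refine IsUltrametricDist.norm_sum_le_of_forall_le_of_nonneg (by positivity) fun i _ => ?_
  rw [norm_smul]
  exact mul_le_mul (norm_le_pi_norm _ i) (hω.1 i) (norm_nonneg _) (norm_nonneg _)

/-- A product that converges uniformly on the sets `Ψ_n` is holomorphic. -/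
lemma tprod_mem_holomorphicFns {ι : Type*} {h : ι → drinfeldSpace P r → P.CInf}
    (hreg : ∀ i, h i ∈ regularFns P r) {c : ℕ → ι → ℝ}
    (hc : ∀ n, Tendsto (c n) cofinite (𝓝 0))
    (hb : ∀ n i, ∀ ω ∈ affinoid P r n, ‖h i ω‖ ≤ c n i) :
    (fun ω => ∏' i, (1 + h i ω)) ∈ holomorphicFns P r := by
  intro n ε hε
  obtain ⟨s, hs⟩ := norm_tprod_sub_prod_le (h := fun i (ω : affinoid P r n) => h i ω) (hc n)
    (fun i ω => hb n i ω ω.2) (half_pos hε)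
  refine ⟨∏ i ∈ s, (1 + h i), prod_mem fun i _ => add_mem (one_mem _) (hreg i), fun ω hω => ?_⟩
  rw [Finset.prod_apply]
  exact (hs ⟨ω, hω⟩).trans_lt (half_lt_self hε)

lemma regularFns_le_holomorphicFns : regularFns P r ≤ holomorphicFns P r :=
  fun f hf n ε hε => ⟨f, hf, fun ω _ => by rwa [sub_self, norm_zero]⟩

/-- Indexing by `Y` instead of `Y_ω` makes the index set independent of `ω`, as is required to view
the product as a function on `Ψ`. -/
lemma latticeExp_image (Y : Lattice P r) {ω : Fin r → P.CInf} (hω : ω ∈ drinfeldSpace P r)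
    (z : P.CInf) : latticeExp (Y.image ω) z =
      z * ∏' y : {y : Fin r → K // y ∈ Y.1 ∧ y ≠ 0}, (1 - z / embed ω y) := by
  have hinj := embed_injective hω
  let f : {y : Fin r → K // y ∈ Y.1 ∧ y ≠ 0} → {l : P.CInf // l ∈ Y.image ω ∧ l ≠ 0} := fun y =>
    ⟨embed ω y.1, (embed_mem_image hω).mpr y.2.1, fun h => y.2.2 (hinj (h.trans (map_zero _).symm))⟩
  have hf : Function.Bijective f := by
    refine ⟨fun a b hab => Subtype.ext (hinj (congrArg Subtype.val hab)), ?_⟩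
    rintro ⟨_, ⟨y, hy, rfl⟩, h0⟩
    exact ⟨⟨y, hy, fun h => h0 (by rw [h]; exact map_zero _)⟩, rfl⟩
  rw [latticeExp, ← (Equiv.ofBijective f hf).tprod_eq]
  rfl

variable {F : Type*} [Field F] [Finite F] [Algebra F K]

lemma tendsto_div_norm_toKInf_sub
    (hfd : ∀ t : K, Transcendental F t → FiniteDimensional F⟮t⟯ K)
    (hF : ∀ x : K, IsAlgebraic F x → x ∈ Set.range (algebraMap F K)) (Y : Lattice P r)
    (w : Fin r → K) (B : ℝ) :
    Tendsto (fun y : {y : Fin r → K // y ∈ Y.1 ∧ y ≠ 0} => B / ‖toKInf (P := P) (y.1 - w)‖)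
      cofinite (𝓝 0) := by
  refine Tendsto.const_div_atTop (tendsto_atTop.mpr fun b => ?_) B
  have hfin := (Lattice.finite_absVal_le hfd hF Y (b + ‖toKInf (P := P) w‖)).preimage
    (f := fun y : {y : Fin r → K // y ∈ Y.1 ∧ y ≠ 0} => y.1) Subtype.val_injective.injOn
  refine hfin.subset fun y hy => ⟨y.2.1, fun i => (absVal_le_norm_toKInf y.1 i).trans ?_⟩
  have hy' : ‖toKInf (P := P) (y.1 - w)‖ ≤ b :=
    le_of_not_ge hy
  calc ‖toKInf (P := P) y.1‖ = ‖toKInf (P := P) (y.1 - w) + toKInf w‖ := by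
        rw [toKInf_sub, sub_add_cancel]
    _ ≤ ‖toKInf (P := P) (y.1 - w)‖ + ‖toKInf (P := P) w‖ := norm_add_le _ _
    _ ≤ _ := by gcongr

lemma tendsto_div_embed_sub
    (hfd : ∀ t : K, Transcendental F t → FiniteDimensional F⟮t⟯ K)
    (hF : ∀ x : K, IsAlgebraic F x → x ∈ Set.range (algebraMap F K)) (Y : Lattice P r)
    (w : Fin r → K) {ω : Fin r → P.CInf} (hω : ω ∈ drinfeldSpace P r) (z : P.CInf) :
    Tendsto (fun y : {y : Fin r → K // y ∈ Y.1 ∧ y ≠ 0} => z * (embed ω (y.1 - w))⁻¹)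
      cofinite (𝓝 0) := by
  have h := (isStronglyDiscrete_image hfd hF Y hω).tendsto_div_add z (-embed ω w)
  let f : {y : Fin r → K // y ∈ Y.1 ∧ y ≠ 0} → (Y.image ω : Set P.CInf) := fun y =>
    ⟨embed ω y.1, (embed_mem_image hω).mpr y.2.1⟩
  have hf : Function.Injective f := fun a b hab =>
    Subtype.ext (embed_injective hω (congrArg Subtype.val hab))
  refine (h.comp hf.tendsto_cofinite).congr fun y => ?_
  change z / (-embed ω w + embed ω y.1) = _
  rw [map_sub, neg_add_eq_sub, div_eq_mul_inv]

/-- The shift `w` serves two purposes: `w = 0` gives the product for `d_u`, and `w = u` the product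
for its inverse. -/
lemma tprod_embed_mem_holomorphicFns
    (hfd : ∀ t : K, Transcendental F t → FiniteDimensional F⟮t⟯ K)
    (hF : ∀ x : K, IsAlgebraic F x → x ∈ Set.range (algebraMap F K)) (Y : Lattice P r)
    {w : Fin r → K} (hw : ∀ y : {y : Fin r → K // y ∈ Y.1 ∧ y ≠ 0}, y.1 - w ≠ 0)
    (u : Fin r → K) :
    (fun ω : drinfeldSpace P r => ∏' y : {y : Fin r → K // y ∈ Y.1 ∧ y ≠ 0},
      (1 + embed ω.1 u * (embed ω.1 (y.1 - w))⁻¹)) ∈ holomorphicFns P r := by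
  let h : {y : Fin r → K // y ∈ Y.1 ∧ y ≠ 0} → drinfeldSpace P r → P.CInf :=
    fun y ω => embed ω.1 u * (embed ω.1 (y.1 - w))⁻¹
  have hreg : ∀ y, h y ∈ regularFns P r := fun y =>
    mul_mem (embed_mem_regularFns u) (inv_embed_mem_regularFns (hw y))
  have hb : ∀ (n : ℕ) (y : {y : Fin r → K // y ∈ Y.1 ∧ y ≠ 0}), ∀ ω ∈ affinoid P r n,
      ‖h y ω‖ ≤ ‖toKInf (P := P) u‖ * (P.qInf : ℝ) ^ n * (P.qInf : ℝ) ^ n /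
        ‖toKInf (P := P) (y.1 - w)‖ := fun n y ω hω => by
    rw [norm_mul, mul_div_assoc]
    exact mul_le_mul (norm_embed_le u hω) (norm_inv_embed_le (hw y) hω) (norm_nonneg _)
      (by positivity)
  exact tprod_mem_holomorphicFns hreg
    (fun n => tendsto_div_norm_toKInf_sub hfd hF Y w _) hb

/-- The division functions are holomorphic and have holomorphic inverses. -/
lemma exists_units_eq_divisionFn
    (hfd : ∀ t : K, Transcendental F t → FiniteDimensional F⟮t⟯ K)
    (hF : ∀ x : K, IsAlgebraic F x → x ∈ Set.range (algebraMap F K)) (Y : Lattice P r)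
    {u : Fin r → K} (hu : u ∉ Y.1) :
    ∃ f : (holomorphicFns P r)ˣ, ∀ ω : drinfeldSpace P r, f.1.1 ω = divisionFn u Y ω.1 := by
  have hu0 : u ≠ 0 := fun h => hu (h ▸ Y.1.zero_mem)
  have hyu : ∀ y : {y : Fin r → K // y ∈ Y.1 ∧ y ≠ 0}, y.1 - u ≠ 0 := fun y h =>
    hu (sub_eq_zero.mp h ▸ y.2.1)
  have hemb : ∀ (ω : drinfeldSpace P r) {y : Fin r → K}, y ≠ 0 → embed ω.1 y ≠ 0 :=
    fun ω y hy h => hy (embed_injective ω.2 (h.trans (map_zero _).symm))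
  -- The inverse `g` is again a product, because `(1 - uω/yω)⁻¹ = 1 + uω/((y - u)ω)`. The
  -- denominators do not vanish since `u ∉ Y`.
  let f : holomorphicFns P r :=
    ⟨_, mul_mem (regularFns_le_holomorphicFns (embed_mem_regularFns u))
      (tprod_embed_mem_holomorphicFns hfd hF Y (w := 0) (fun y => by rw [sub_zero]; exact y.2.2) (-u))⟩
  let g : holomorphicFns P r :=
    ⟨_, mul_mem (regularFns_le_holomorphicFns (inv_embed_mem_regularFns hu0))
      (tprod_embed_mem_holomorphicFns hfd hF Y hyu u)⟩
  have hfg : f * g = 1 := by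
    refine Subtype.ext (funext fun ω => ?_)
    have h := (multipliable_one_add_of_tendsto (tendsto_div_embed_sub hfd hF Y 0 ω.2
      (embed ω.1 (-u)))).tprod_mul (multipliable_one_add_of_tendsto
        (tendsto_div_embed_sub hfd hF Y u ω.2 (embed ω.1 u)))
    have h1 : ∀ y : {y : Fin r → K // y ∈ Y.1 ∧ y ≠ 0},
        (1 + embed ω.1 (-u) * (embed ω.1 (y.1 - 0))⁻¹) *
          (1 + embed ω.1 u * (embed ω.1 (y.1 - u))⁻¹) = 1 := fun y => by
      have hy := hemb ω y.2.2
      have hyu := hemb ω (hyu y)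
      rw [map_sub] at hyu
      rw [sub_zero, map_sub, map_neg]
      field_simp
      ring
    simp_rw [h1, tprod_one] at h
    change (embed ω.1 u * _) * ((embed ω.1 u)⁻¹ * _) = 1
    rw [mul_mul_mul_comm, ← h, mul_inv_cancel₀ (hemb ω hu0), one_mul]
  refine ⟨⟨f, g, hfg, mul_comm f g ▸ hfg⟩, fun ω => ?_⟩
  rw [divisionFn, latticeExp_image Y ω.2]
  refine congrArg (embed ω.1 u * ·) (tprod_congr fun y => ?_)
  rw [sub_zero, map_neg, neg_mul, ← sub_eq_add_neg, div_eq_mul_inv]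

end Holomorphy

end DrinfeldDist

end

/-! ### The distribution relation and the two derived distributions -/

theorem mainTheorem12 {F K : Type*} [Field F] [Finite F] [Field K]
    [Algebra F⟮X⟯ K] [FunctionField F K] [Algebra F K] [IsScalarTower F F⟮X⟯ K]
    (hF : ∀ x : K, IsAlgebraic F x → x ∈ Set.range (algebraMap F K))
    (P : DrinfeldDist.Place K) (r : ℕ) (hr : 1 ≤ r) :
    -- the products that define the exponential functions converge
    (∀ (Y : DrinfeldDist.Lattice P r), ∀ ω ∈ DrinfeldDist.drinfeldSpace P r, ∀ z : P.CInf,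
      Multipliable fun l : {l : P.CInf // l ∈ Y.image ω ∧ l ≠ 0} => 1 - z / (l : P.CInf)) ∧
    -- the polynomial whose leading coefficient is the discriminant exists and is unique
    (∀ (Y Y' : DrinfeldDist.Lattice P r), Y.1 ≤ Y'.1 → ∀ ω ∈ DrinfeldDist.drinfeldSpace P r,
      ∃! φ, DrinfeldDist.IsNormalizedIsogeny F (Y.image ω) (Y'.image ω) φ) ∧
    -- the distribution relation
    (∀ (Y Y' : DrinfeldDist.Lattice P r) (h : Y.1 ≤ Y'.1) (v : Fin r → K), v ∉ Y'.1 →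
      (DrinfeldDist.classesOver h v).Finite ∧
      ∀ ω ∈ DrinfeldDist.drinfeldSpace P r,
        DrinfeldDist.discrFn F Y Y' ω *
            (∏ᶠ x ∈ DrinfeldDist.classesOver h v, DrinfeldDist.divisionFn x.out Y ω) =
          DrinfeldDist.divisionFn v Y' ω) ∧
    -- derived distribution with values in the units of the ring of holomorphic functions
    (∃ g : DrinfeldDist.PuncturedDomain P r → (DrinfeldDist.holomorphicFns P r)ˣ,
      (∀ (x : DrinfeldDist.PuncturedDomain P r) (ω : DrinfeldDist.drinfeldSpace P r),
        (g x).1.1 ω = DrinfeldDist.divisionFn x.1.1 x.1.2 ω.1) ∧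
      DrinfeldDist.IsDerivedDistribution g ∧
      ∀ (Y Y' : DrinfeldDist.Lattice P r) (h : Y.1 ≤ Y'.1) (ω : DrinfeldDist.drinfeldSpace P r),
        (DrinfeldDist.Disc g h).1.1 ω = DrinfeldDist.discrFn F Y Y' ω.1) ∧
    -- derived distribution with values in the multiplicative group, for fixed `ω`
    (∀ ω ∈ DrinfeldDist.drinfeldSpace P r,
      ∃ g : DrinfeldDist.PuncturedDomain P r → P.CInfˣ,
        (∀ x : DrinfeldDist.PuncturedDomain P r,
          (g x : P.CInf) = DrinfeldDist.divisionFn x.1.1 x.1.2 ω) ∧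
        DrinfeldDist.IsDerivedDistribution g ∧
        ∀ (Y Y' : DrinfeldDist.Lattice P r) (h : Y.1 ≤ Y'.1),
          ((DrinfeldDist.Disc g h : P.CInfˣ) : P.CInf) = DrinfeldDist.discrFn F Y Y' ω) := by
  have hfd : ∀ t : K, Transcendental F t → FiniteDimensional (IntermediateField.adjoin F {t}) K :=
    fun t ht => FunctionField.finiteDimensional_of_adjoin_transcendental ht
  refine ⟨fun Y ω hω z => ?_, fun Y Y' h ω hω => ?_, fun Y Y' h v _ => ⟨?_, fun ω hω => ?_⟩,
    ?_, fun ω hω => ?_⟩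
  · exact DrinfeldDist.multipliable_latticeExp hfd hF Y hω z
  · obtain ⟨φ, hφ, huniq, -⟩ := DrinfeldDist.existsUnique_isogeny hfd hF h hω
    exact ⟨φ, hφ, huniq⟩
  · exact DrinfeldDist.finite_classesOver hfd hF h v
  · exact DrinfeldDist.discrFn_mul_finprod_divisionFn hfd hF h hω v
  -- Evaluations at the points of `Ψ` separate holomorphic functions, so the pointwise relations
  -- suffice.
  · choose f hf using fun x : DrinfeldDist.PuncturedDomain P r =>
      DrinfeldDist.exists_units_eq_divisionFn hfd hF x.1.2 x.2
    obtain ⟨h1, h2⟩ := DrinfeldDist.isDerivedDistribution_of_eval f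
      (fun u Y (ω : DrinfeldDist.drinfeldSpace P r) => DrinfeldDist.divisionFn u Y ω.1)
      (fun Y Y' ω => DrinfeldDist.discrFn F Y Y' ω.1)
      (fun ω => ((Pi.evalMonoidHom _ ω).comp
        (DrinfeldDist.holomorphicFns P r).val.toMonoidHom).comp (Units.coeHom _))
      (fun m m' hm => Units.ext (Subtype.ext (funext hm)))
      (fun u Y hu ω => hf ⟨(u, Y), hu⟩ ω)
      (fun Y u u' ω => DrinfeldDist.divisionFn_congr hfd hF Y ω.2)
      (fun h v => DrinfeldDist.finite_classesOver hfd hF h v)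
      (fun h ω => DrinfeldDist.discrFn_mul_finprod_divisionFn_eq_one hfd hF h ω.2)
      (fun h v ω => DrinfeldDist.discrFn_mul_finprod_divisionFn hfd hF h ω.2 v)
    exact ⟨f, hf, h1, h2⟩
  -- With `ω` fixed, a single evaluation, the inclusion of the units in the field, is already
  -- separating.
  · obtain ⟨h1, h2⟩ := DrinfeldDist.isDerivedDistribution_of_eval
      (fun x : DrinfeldDist.PuncturedDomain P r => Units.mk0 (DrinfeldDist.divisionFn x.1.1 x.1.2 ω)
        (mt (DrinfeldDist.divisionFn_eq_zero_iff hfd hF x.1.2 hω x.1.1).mp x.2))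
      (fun u Y (_ : Unit) => DrinfeldDist.divisionFn u Y ω)
      (fun Y Y' _ => DrinfeldDist.discrFn F Y Y' ω)
      (fun _ => Units.coeHom P.CInf)
      (fun m m' hm => Units.ext (hm ()))
      (fun _ _ _ _ => rfl)
      (fun Y u u' _ => DrinfeldDist.divisionFn_congr hfd hF Y hω)
      (fun h v => DrinfeldDist.finite_classesOver hfd hF h v)
      (fun h _ => DrinfeldDist.discrFn_mul_finprod_divisionFn_eq_one hfd hF h hω)
      (fun h v _ => DrinfeldDist.discrFn_mul_finprod_divisionFn hfd hF h hω v)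
    exact ⟨_, fun _ => rfl, h1, fun Y Y' h => h2 Y Y' h ()⟩
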